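/- Let $d,p\ge 1$ be integers, let $\Delta$ be the discrete Laplacian $(\Delta u)_n=\sum_{|k-n|=1}(u_k-u_n)$ on $\ell^2(\mathbb{Z}^d)$ (complex sequences), and let $\gamma_p=\binom{1+2p}{1+p}$. Let $\Omega\in\mathbb{R}\setminus[-4d,0]$, and let $\mathcal{A}\in\ell^2(\mathbb{Z}^d)$ be a real solution of the stationary dNLS equation $\Omega\mathcal{A}+\gamma_p|\mathcal{A}|^{2p}\mathcal{A}=\Delta\mathcal{A}$ such that $J_\Omega=\Omega+(1+2p)\gamma_p|\mathcal{A}|^{2p}-\Delta$ has trivial null space in $\ell^2(\mathbb{Z}^d)$. On $\ell^2(\mathbb{Z}^d)\times\ell^2(\mathbb{Z}^d)$ let $$\mathcal{L}=\begin{bmatrix}0&-(\Omega-\Delta+\gamma_p\mathcal{A}^{2p})\\ \Omega-\Delta+\gamma_p(1+2p)\mathcal{A}^{2p}&0\end{bmatrix}.$$ Let $\Lambda\in i\mathbb{R}\setminus\{0\}$ be such that $2\Lambda$ is a simple (algebraic multiplicity one) isolated eigenvalue of $\mathcal{L}$ with $2\Lambda\notin i[\Omega,\Omega+4d]\cup -i[\Omega,\Omega+4d]$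 (the continuous spectrum of $\mathcal{L}$), and let $(b_+,b_-)\ne 0$ be an eigenvector, $\mathcal{L}(b_+,b_-)^T=2\Lambda(b_+,b_-)^T$. Let $\ell^{2,2}$ be the space of sequences $B=\{B^{(m)}\}_{m\in\mathbb{Z}}$ in $\ell^2(\mathbb{Z}^d)$ with $\sum_m(1+m^2)^2\|B^{(m)}\|^2<\infty$. A *breather branch* consists of $\epsilon_1>0$, $C_1\in\mathbb{R}$ and real-analytic maps $\omega:(0,\epsilon_1)\to\mathbb{R}$, $A:(0,\epsilon_1)\to\ell^{2,2}$, with $A^{(m)}$ real and $A^{(-m)}=A^{(m)}$, such that, with $U(\tau)=\sum_m A^{(m)}e^{im\tau}$ and componentwise powers, for all $\epsilon\in(0,\epsilon_1)$ and $m\in\mathbb{Z}$, $$(1-m^2\omega^2)A^{(m)}+\frac{\epsilon}{2\pi}\int_{-\pi}^{\pi}U^{1+2p}(\tau)e^{-im\tau}\,d\tau=\epsilon\Delta A^{(m)},$$ $$\left|\omega-1+\tfrac12\epsilon\Omega\right|\le C_1\epsilon^2,\qquad \|A^{(0)}\|+\|A^{(1)}-\mathcal{A}\|+\sum_{m\ge2}\|A^{(m)}\|\le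 C_1\epsilon .$$ Then a breather branch exists. Moreover, for every breather branch there are $\epsilon_0\in(0,\epsilon_1]$, $C_0>0$, $\delta>0$ with $C_0\epsilon_0\le\delta$ and real-analytic maps $\lambda:(0,\epsilon_0)\to\mathbb{C}$, $B:(0,\epsilon_0)\to\ell^{2,2}$ such that, for every $\epsilon\in(0,\epsilon_0)$, $\lambda(\epsilon)\in i\mathbb{R}$ and $B(\epsilon)\neq0$; with $\lambda=\lambda(\epsilon)$, $B=B(\epsilon)$ and $W(\tau)=\sum_m B^{(m)}e^{im\tau}$, the linearized dKG spectral problem $$\left[1+(\lambda+im\omega)^2\right]B^{(m)}+\frac{\epsilon(1+2p)}{2\pi}\int_{-\pi}^{\pi}U^{2p}(\tau)W(\tau)e^{-im\tau}\,d\tau=\epsilon\Delta B^{(m)},\qquad m\in\mathbb{Z},$$ holds; and $$|\lambda(\epsilon)-\epsilon\Lambda|\le C_0\epsilon^2,\qquad \|B^{(1)}-b_+-ib_-\|+\|B^{(-1)}-b_++ib_-\|\le C_0\epsilon,\qquad \|B^{(0)}\|+\sum_{|m|\ge2}\|B^{(m)}\|\le C_0\epsilon .$$ The branch is unique in the following sense: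 for every $\epsilon\in(0,\epsilon_0)$, if $\mu\in\mathbb{C}$ with $|\mu-\epsilon\Lambda|<\delta\epsilon$ and $0\ne B'\in\ell^{2,2}$ solve the same spectral problem, then $\mu=\lambda(\epsilon)$ and $B'$ is a scalar multiple of $B(\epsilon)$. -/

import Mathlib

namespace KleinGordon

open Complex

noncomputable section

/-- The Hilbert space `ℓ²(ℤ^d)` of complex square-summable sequences on the cubic lattice. -/
abbrev Latt (d : ℕ) : Type := lp (fun _ : Fin d → ℤ => ℂ) 2

theorem memlp_shift {d : ℕ} (v : Fin d → ℤ) (u : Latt d) :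
    Memℓp (fun n : Fin d → ℤ => u (n + v)) 2 := by
  apply memℓp_gen
  exact (Equiv.addRight v).summable_iff.mpr ((lp.memℓp u).summable (by norm_num))

/-- The translation `(shift v u)_n = u_{n+v}` on `ℓ²(ℤ^d)`. -/
def shift {d : ℕ} (v : Fin d → ℤ) : Latt d →L[ℂ] Latt d :=
  LinearMap.mkContinuous
    { toFun := fun u => ⟨fun n => u (n + v), memlp_shift v u⟩
      map_add' := fun _ _ => rfl
      map_smul' := fun _ _ => rfl }
    1 (by
      intro u
      rw [one_mul]
      apply lp.norm_le_of_tsum_le (by norm_num) (norm_nonneg u)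
      rw [lp.norm_rpow_eq_tsum (by norm_num) u]
      exact ((Equiv.addRight v).tsum_eq
        (fun n => ‖u n‖ ^ (2 : ENNReal).toReal)).le)

/-- The discrete Laplacian `(Δ u)_n = ∑_{|k-n|=1} (u_k - u_n)` on `ℓ²(ℤ^d)`. -/
def lap (d : ℕ) : Latt d →L[ℂ] Latt d :=
  ∑ j : Fin d, (shift (Pi.single j 1) + shift (-Pi.single j 1)
    - (2 : ℂ) • ContinuousLinearMap.id ℂ (Latt d))

theorem norm_pow_mul_le {d : ℕ} (a u : Latt d) (k : ℕ) (n : Fin d → ℤ) :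
    ‖((‖a n‖ : ℂ) ^ k) * u n‖ ≤ ‖((‖a‖ : ℂ) ^ k • u) n‖ := by
  rw [lp.coeFn_smul, Pi.smul_apply, smul_eq_mul, norm_mul, norm_mul, norm_pow, norm_pow,
    norm_real, norm_real, norm_norm, norm_norm]
  gcongr
  exact lp.norm_apply_le_norm (by norm_num) a n

theorem memlp_mulAbsPow {d : ℕ} (a u : Latt d) (k : ℕ) :
    Memℓp (fun n : Fin d → ℤ => ((‖a n‖ : ℂ) ^ k) * u n) 2 :=
  (lp.memℓp ((‖a‖ : ℂ) ^ k • u)).mono' (norm_pow_mul_le a u k)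

/-- The multiplication operator `u ↦ |a|^k u` on `ℓ²(ℤ^d)`. -/
def mulAbsPow {d : ℕ} (a : Latt d) (k : ℕ) : Latt d →L[ℂ] Latt d :=
  LinearMap.mkContinuous
    { toFun := fun u => ⟨fun n => ((‖a n‖ : ℂ) ^ k) * u n, memlp_mulAbsPow a u k⟩
      map_add' := fun u w => by
        ext n
        exact mul_add _ (u n) (w n)
      map_smul' := fun c u => by
        ext n
        exact mul_left_comm _ c (u n) }
    (‖a‖ ^ k) (by
      intro u
      have h : ‖((‖a‖ : ℂ) ^ k • u)‖ = ‖a‖ ^ k * ‖u‖ := by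
        rw [norm_smul, norm_pow, norm_real, norm_norm]
      rw [← h]
      exact lp.norm_mono (by norm_num) (norm_pow_mul_le a u k))

/-- The coefficient `γ_p`. -/
def gam (p : ℕ) : ℝ := ((1 + 2 * p).choose (1 + p) : ℝ)

/-- The bounded operator `Ω - Δ + c γ_p |a|^{2p}` on `ℓ²(ℤ^d)`. -/
def schr {d : ℕ} (p : ℕ) (Ω c : ℝ) (a : Latt d) : Latt d →L[ℂ] Latt d :=
  (Ω : ℂ) • ContinuousLinearMap.id ℂ (Latt d) - lap d
    + ((c * gam p : ℝ) : ℂ) • mulAbsPow a (2 * p)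

/-- `a` is a real solution in `ℓ²(ℤ^d)` of the stationary dNLS equation
`Ω a + γ_p |a|^{2p} a = Δ a`. -/
def IsSoliton {d : ℕ} (p : ℕ) (Ω : ℝ) (a : Latt d) : Prop :=
  (∀ n, (a n).im = 0) ∧
    (Ω : ℂ) • a + (gam p : ℂ) • mulAbsPow a (2 * p) a = lap d a

/-- The Jacobian operator `J_Ω = Ω + (1+2p) γ_p |a|^{2p} - Δ` of the stationary dNLS equation. -/
def jac {d : ℕ} (p : ℕ) (Ω : ℝ) (a : Latt d) : Latt d →L[ℂ] Latt d :=
  schr p Ω (1 + 2 * p) a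

/-- The linearised dNLS operator
`(b₊, b₋) ↦ (-(Ω - Δ + γ_p a^{2p}) b₋, (Ω - Δ + γ_p (1+2p) a^{2p}) b₊)`
on `ℓ²(ℤ^d) × ℓ²(ℤ^d)`. -/
def linNLS {d : ℕ} (p : ℕ) (Ω : ℝ) (a : Latt d) :
    (Latt d × Latt d) →L[ℂ] (Latt d × Latt d) :=
  (-((schr p Ω 1 a).comp (ContinuousLinearMap.snd ℂ (Latt d) (Latt d)))).prod
    ((jac p Ω a).comp (ContinuousLinearMap.fst ℂ (Latt d) (Latt d)))

/-- The continuous spectrum `i[Ω, Ω+4d] ∪ -i[Ω, Ω+4d]` of the linearised dNLS operator. -/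
def contSpec (d : ℕ) (Ω : ℝ) : Set ℂ :=
  {z | ∃ s ∈ Set.Icc Ω (Ω + 4 * d), z = I * s ∨ z = -(I * s)}

/-- `z` is an isolated point of the spectrum of `T` and an eigenvalue of algebraic
multiplicity one. -/
structure IsSimpleIsolatedEigenvalue {F : Type*} [NormedAddCommGroup F] [NormedSpace ℂ F]
    (T : F →L[ℂ] F) (z : ℂ) : Prop where
  isolated : ∃ r > 0, ∀ w ∈ spectrum ℂ T, ‖w - z‖ < r → w = z
  simple : Module.finrank ℂ (Module.End.maxGenEigenspace (T : F →ₗ[ℂ] F) z) = 1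

/-- The weighted sequence `m ↦ (1 + m²) B^{(m)}`; the norm of `B` in `ℓ^{2,2}(ℤ; ℓ²(ℤ^d))` is
the `ℓ²(ℤ; ℓ²(ℤ^d))` norm of this sequence. -/
def weighted {d : ℕ} (B : ℤ → Latt d) : ℤ → Latt d :=
  fun m => (1 + (m : ℂ) ^ 2) • B m

/-- Membership in `ℓ^{2,2}(ℤ; ℓ²(ℤ^d))`. -/
def MemL22 {d : ℕ} (B : ℤ → Latt d) : Prop := Memℓp (weighted B) 2

/-- On the set `s`, `ε ↦ B ε` is a real-analytic map into `ℓ^{2,2}(ℤ; ℓ²(ℤ^d))`. The latter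
space is identified isometrically with `ℓ²(ℤ; ℓ²(ℤ^d))` by means of the weights. -/
def AnalyticL22On {d : ℕ} (B : ℝ → ℤ → Latt d) (s : Set ℝ) : Prop :=
  ∃ F : ℝ → lp (fun _ : ℤ => Latt d) 2,
    AnalyticOnNhd ℝ F s ∧ ∀ ε ∈ s, ∀ m, F ε m = weighted (B ε) m

/-- The component at the site `n` of the Fourier series `∑_{m ∈ ℤ} B^{(m)} e^{imτ}`. -/
def fourierSum {d : ℕ} (B : ℤ → Latt d) (n : Fin d → ℤ) (τ : ℝ) : ℂ :=
  ∑' m : ℤ, B m n * exp (I * m * τ)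

/-- The breather equation in Fourier coefficients, for coefficients `A ∈ ℓ^{2,2}(ℤ; ℓ²(ℤ^d))`
that are real and even in `m`. -/
structure IsBreather {d : ℕ} (p : ℕ) (ε ω : ℝ) (A : ℤ → Latt d) : Prop where
  mem : MemL22 A
  real : ∀ m n, (A m n).im = 0
  even : ∀ m, A (-m) = A m
  eqn : ∀ (m : ℤ) (n : Fin d → ℤ),
    (1 - (m : ℂ) ^ 2 * (ω : ℂ) ^ 2) * A m n
      + (ε : ℂ) / (2 * Real.pi) *
        ∫ τ in (-Real.pi)..Real.pi, fourierSum A n τ ^ (1 + 2 * p) * exp (-(I * m * τ))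
      = ε * lap d (A m) n

/-- An analytic branch of fundamental breathers over `0 < ε < ε₁` that bifurcates from the
dNLS soliton `a`. -/
structure IsBreatherBranch {d : ℕ} (p : ℕ) (Ω : ℝ) (a : Latt d) (ε₁ C₁ : ℝ)
    (ω : ℝ → ℝ) (A : ℝ → ℤ → Latt d) : Prop where
  pos : 0 < ε₁
  analytic_freq : AnalyticOnNhd ℝ ω (Set.Ioo 0 ε₁)
  analytic_coeff : AnalyticL22On A (Set.Ioo 0 ε₁)
  breather : ∀ ε ∈ Set.Ioo 0 ε₁, IsBreather p ε (ω ε) (A ε)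
  bound_freq : ∀ ε ∈ Set.Ioo 0 ε₁, |ω ε - 1 + ε * Ω / 2| ≤ C₁ * ε ^ 2
  bound_coeff : ∀ ε ∈ Set.Ioo 0 ε₁,
    ‖A ε 0‖ + ‖A ε 1 - a‖ + ∑' m : ℕ, ‖A ε (m + 2)‖ ≤ C₁ * ε

/-- `(μ, B)` is an eigenvalue-eigenvector pair of the linearisation of the dKG equation at the
breather with frequency `ω` and Fourier coefficients `A`, written in Fourier coefficients. -/
structure IsEigenpair {d : ℕ} (p : ℕ) (ε ω : ℝ) (A : ℤ → Latt d) (μ : ℂ) (B : ℤ → Latt d) :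
    Prop where
  mem : MemL22 B
  ne_zero : B ≠ 0
  eqn : ∀ (m : ℤ) (n : Fin d → ℤ),
    (1 + (μ + I * m * ω) ^ 2) * B m n
      + (ε : ℂ) * (1 + 2 * p) / (2 * Real.pi) *
        ∫ τ in (-Real.pi)..Real.pi,
          fourierSum A n τ ^ (2 * p) * fourierSum B n τ * exp (-(I * m * τ))
      = ε * lap d (B m) n

end

end KleinGordon

/-!
After division by `ε` of the equations for the modes `m = ±1`, and with `θ = (1 - ω²) / ε` in place
of `ω` there, the dKG operator extends analytically to `ε = 0`, where the modes decouple: the mode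
`m ≠ ±1` is multiplied by `1 - m² ≠ 0`, while the modes `±1` carry the stationary dNLS equation or
its linearization. Since `ℓ^{2,2} ⊂ ℓ¹` in the Fourier index, multiplication by `U` is a convolution
which depends boundedly on `U`, so the implicit function theorem applies in `ℓ^{2,2}` as soon as
the limit operator is invertible; as multiplication by `|a|^{2p}` is compact, this only requires
injectivity.

For the breathers, injectivity fails in the direction of a time translation, which is odd in `m`.
A correction which vanishes on even sequences removes that kernel without changing the even
solutions, and uniqueness makes the solution even and real.

For the eigenvalues, the limit operator has a one-dimensional kernel, and a rank-one bordering
turns the simple eigenvalue into a regular zero of a scalar analytic function. The spectral problem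
is invariant under `λ ↦ -λ̄`, so uniqueness forces `λ ∈ iℝ`.
-/

namespace KleinGordon

open Complex Filter Topology
open scoped lp

noncomputable section

theorem summable_norm_of_l1 {ι V : Type*} [NormedAddCommGroup V] (f : ℓ¹(ι, V)) :
    Summable fun k => ‖f k‖ := by
  simpa using (lp.memℓp f).summable (by norm_num)

theorem norm_apply_le_norm {ι V : Type*} [NormedAddCommGroup V] (F : ℓ²(ι, V)) (i : ι) :
    ‖F i‖ ≤ ‖F‖ :=
  lp.norm_apply_le_norm two_ne_zero F i

section SequenceOperators

variable {ι κ G E : Type*} [NormedAddCommGroup E] [NormedSpace ℂ E] [AddCommGroup G]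

/-- Reindexing of square-summable sequences by a bijection of the index sets. -/
def reindex (e : κ ≃ ι) : ℓ²(ι, E) →L[ℂ] ℓ²(κ, E) :=
  LinearMap.mkContinuous
    { toFun := fun F => ⟨fun k => F (e k), by
        apply memℓp_gen
        exact e.summable_iff.mpr ((lp.memℓp F).summable (by norm_num))⟩
      map_add' := fun _ _ => rfl
      map_smul' := fun _ _ => rfl }
    1 (by
      intro F
      rw [one_mul]
      apply lp.norm_le_of_tsum_le (by norm_num) (norm_nonneg F)
      rw [lp.norm_rpow_eq_tsum (by norm_num) F]
      exact (e.tsum_eq (fun i => ‖F i‖ ^ (2 : ENNReal).toReal)).le)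

theorem norm_reindex_le (e : κ ≃ ι) : ‖(reindex e : ℓ²(ι, E) →L[ℂ] ℓ²(κ, E))‖ ≤ 1 :=
  LinearMap.mkContinuous_norm_le _ zero_le_one _

/-- The translation `(modeShift k F)_m = F_{m-k}`; on Fourier coefficients it is the multiplication
of the Fourier series by `e^{ikτ}`. -/
def modeShift (k : G) : ℓ²(G, E) →L[ℂ] ℓ²(G, E) := reindex (Equiv.subRight k)

@[simp]
theorem modeShift_apply (k : G) (F : ℓ²(G, E)) (m : G) : modeShift k F m = F (m - k) := rfl

theorem modeShift_zero : (modeShift 0 : ℓ²(G, E) →L[ℂ] ℓ²(G, E)) = 1 := by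
  ext F : 1
  exact lp.ext (funext fun m => by simp)

theorem modeShift_mul (j k : G) :
    (modeShift j * modeShift k : ℓ²(G, E) →L[ℂ] ℓ²(G, E)) = modeShift (j + k) := by
  ext F : 1
  exact lp.ext (funext fun m => by simp [sub_sub])

theorem modeShift_pow (k : G) (j : ℕ) :
    (modeShift k ^ j : ℓ²(G, E) →L[ℂ] ℓ²(G, E)) = modeShift (j • k) := by
  induction j with
  | zero => rw [pow_zero, zero_nsmul, modeShift_zero]
  | succ j ih => rw [pow_succ, ih, modeShift_mul, succ_nsmul]

/-- The action of an operator on every term of a sequence. -/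
def mapModes : (E →L[ℂ] E) →L[ℂ] (ℓ²(ι, E) →L[ℂ] ℓ²(ι, E)) :=
  LinearMap.mkContinuous
    { toFun := fun K => lp.mapCLM 2 (fun _ => K) (norm_nonneg K) (fun _ => le_rfl)
      map_add' := fun _ _ => rfl
      map_smul' := fun _ _ => rfl }
    1 (fun K => by
      rw [one_mul]
      exact lp.norm_mapCLM_le 2 _ (norm_nonneg K) (fun _ => le_rfl))

@[simp]
theorem mapModes_apply (K : E →L[ℂ] E) (F : ℓ²(ι, E)) (i : ι) : mapModes K F i = K (F i) := rfl

theorem norm_mapModes_le (K : E →L[ℂ] E) :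
    ‖(mapModes K : ℓ²(ι, E) →L[ℂ] ℓ²(ι, E))‖ ≤ ‖K‖ :=
  lp.norm_mapCLM_le 2 _ (norm_nonneg K) (fun _ => le_rfl)

theorem mapModes_pow (K : E →L[ℂ] E) (j : ℕ) :
    (mapModes (K ^ j) : ℓ²(ι, E) →L[ℂ] ℓ²(ι, E)) = mapModes K ^ j := by
  induction j with
  | zero =>
    ext F : 1
    exact lp.ext (funext fun i => by simp)
  | succ j ih =>
    rw [pow_succ, pow_succ, ← ih]
    ext F : 1
    exact lp.ext (funext fun i => by simp)

theorem modeShift_commute_mapModes (k : G) (K : E →L[ℂ] E) :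
    Commute (modeShift k : ℓ²(G, E) →L[ℂ] ℓ²(G, E)) (mapModes K) := by
  ext F : 1
  exact lp.ext (funext fun m => by simp)

/-- The diagonal operator with a bounded symbol. -/
def multiplier {C : ℝ} (c : ι → ℂ) (hc : ∀ i, ‖c i‖ ≤ C) : ℓ²(ι, E) →L[ℂ] ℓ²(ι, E) :=
  lp.mapCLM 2 (fun i => c i • ContinuousLinearMap.id ℂ E) (abs_nonneg C) fun i =>
    calc ‖c i • ContinuousLinearMap.id ℂ E‖ ≤ ‖c i‖ * 1 := by
          rw [norm_smul]
          gcongr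
          exact ContinuousLinearMap.norm_id_le
      _ ≤ |C| := (mul_one _).trans_le ((hc i).trans (le_abs_self C))

@[simp]
theorem multiplier_apply {C : ℝ} (c : ι → ℂ) (hc : ∀ i, ‖c i‖ ≤ C) (F : ℓ²(ι, E)) (i : ι) :
    multiplier c hc F i = c i • F i := rfl

end SequenceOperators

section SequenceConvolution

variable {G R : Type*} [AddCommGroup G] [NormedRing R]

/-- The shear `(m, k) ↦ (k, m - k)`. -/
def convShear (G : Type*) [AddCommGroup G] : G × G ≃ G × G where
  toFun x := (x.2, x.1 - x.2)
  invFun x := (x.1 + x.2, x.1)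
  left_inv x := by simp
  right_inv x := by simp

variable {u v : G → R}

theorem summable_norm_mul_sub (hu : Summable fun k => ‖u k‖) (hv : Summable fun k => ‖v k‖) :
    Summable fun x : G × G => ‖u x.2 * v (x.1 - x.2)‖ :=
  ((convShear G).summable_iff (f := fun y : G × G => ‖u y.1 * v y.2‖)).mpr (hu.mul_norm hv)

theorem summable_norm_tsum_mul_sub (hu : Summable fun k => ‖u k‖) (hv : Summable fun k => ‖v k‖) :
    Summable fun m => ‖∑' k, u k * v (m - k)‖ := by
  have h := summable_norm_mul_sub hu hv
  exact h.prod.of_nonneg_of_le (fun _ => norm_nonneg _) fun m =>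
    norm_tsum_le_tsum_norm (h.prod_factor m)

theorem tsum_tsum_mul_sub [CompleteSpace R] (hu : Summable fun k => ‖u k‖)
    (hv : Summable fun k => ‖v k‖) :
    ∑' m, ∑' k, u k * v (m - k) = (∑' k, u k) * ∑' k, v k := by
  rw [tsum_mul_tsum_of_summable_norm hu hv, ← (convShear G).tsum_eq]
  exact (summable_norm_mul_sub hu hv).of_norm.tsum_prod.symm

end SequenceConvolution

section OperatorConvolution

variable {G E : Type*} [AddCommGroup G] [NormedAddCommGroup E] [NormedSpace ℂ E]

/-- Application of an operator to every term of a sequence, followed by a translation. -/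
def mulMode (k : G) : (E →L[ℂ] E) →L[ℂ] (ℓ²(G, E) →L[ℂ] ℓ²(G, E)) :=
  (ContinuousLinearMap.compL ℂ ℓ²(G, E) ℓ²(G, E) ℓ²(G, E) (modeShift k)).comp mapModes

@[simp]
theorem mulMode_apply (k : G) (K : E →L[ℂ] E) (F : ℓ²(G, E)) (m : G) :
    mulMode k K F m = K (F (m - k)) := rfl

theorem norm_mulMode_apply_le (k : G) (K : E →L[ℂ] E) : ‖mulMode k K‖ ≤ ‖K‖ :=
  calc ‖mulMode k K‖ ≤ ‖(modeShift k : ℓ²(G, E) →L[ℂ] ℓ²(G, E))‖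
        * ‖(mapModes K : ℓ²(G, E) →L[ℂ] ℓ²(G, E))‖ := ContinuousLinearMap.opNorm_comp_le _ _
    _ ≤ 1 * ‖K‖ := by
        gcongr
        exacts [norm_reindex_le _, norm_mapModes_le K]
    _ = ‖K‖ := one_mul _

theorem norm_mulMode_le (k : G) :
    ‖(mulMode k : (E →L[ℂ] E) →L[ℂ] (ℓ²(G, E) →L[ℂ] ℓ²(G, E)))‖ ≤ 1 :=
  ContinuousLinearMap.opNorm_le_bound _ zero_le_one fun K => by
    simpa only [one_mul] using norm_mulMode_apply_le k K

theorem mulMode_commute {K L : E →L[ℂ] E} (h : Commute K L) (j k : G) :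
    Commute (mulMode j K) (mulMode k L) := by
  ext F : 1
  refine lp.ext (funext fun m => ?_)
  simp only [mul_apply_eq_comp, mulMode_apply]
  rw [sub_right_comm]
  exact DFunLike.congr_fun h _

theorem summable_norm_mulMode (f : ℓ¹(G, E →L[ℂ] E)) : Summable fun k => ‖mulMode k (f k)‖ :=
  (summable_norm_of_l1 f).of_nonneg_of_le (fun _ => norm_nonneg _) fun k =>
    norm_mulMode_apply_le k (f k)

variable [CompleteSpace E]

/-- The convolution by an absolutely summable sequence of operators. -/
def modeConv : ℓ¹(G, E →L[ℂ] E) →L[ℂ] (ℓ²(G, E) →L[ℂ] ℓ²(G, E)) :=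
  (lp.tsumCLM ℂ G (ℓ²(G, E) →L[ℂ] ℓ²(G, E))).comp (lp.mapCLM 1 mulMode zero_le_one norm_mulMode_le)

theorem modeConv_eq_tsum (f : ℓ¹(G, E →L[ℂ] E)) : modeConv f = ∑' k, mulMode k (f k) := rfl

theorem norm_modeConv_le (f : ℓ¹(G, E →L[ℂ] E)) : ‖modeConv f‖ ≤ ∑' k, ‖f k‖ := by
  rw [modeConv_eq_tsum]
  exact (norm_tsum_le_tsum_norm (summable_norm_mulMode f)).trans <|
    (summable_norm_mulMode f).tsum_le_tsum (fun k => norm_mulMode_apply_le k (f k))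
      (summable_norm_of_l1 f)

theorem hasSum_modeConv_apply (f : ℓ¹(G, E →L[ℂ] E)) (F : ℓ²(G, E)) (m : G) :
    HasSum (fun k => f k (F (m - k))) (modeConv f F m) := by
  have h := (summable_norm_mulMode f).of_norm.hasSum
  exact h.mapL ((lp.evalCLM ℂ (fun _ : G => E) 2 m).comp (ContinuousLinearMap.apply ℂ _ F))

theorem commute_modeConv {f g : ℓ¹(G, E →L[ℂ] E)} (h : ∀ j k, Commute (f j) (g k)) :
    Commute (modeConv f) (modeConv g) := by
  have hf := (summable_norm_mulMode f).of_norm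
  have hg := (summable_norm_mulMode g).of_norm
  rw [Commute, SemiconjBy, modeConv_eq_tsum, modeConv_eq_tsum, ← hf.tsum_mul_right,
    ← hf.tsum_mul_left]
  refine tsum_congr fun j => ?_
  rw [← hg.tsum_mul_left, ← hg.tsum_mul_right]
  exact tsum_congr fun k => mulMode_commute (h j k) _ _

end OperatorConvolution

section SiteMultiplication

variable {ι : Type*}

theorem norm_mul_apply_le (u : ℓ²(ι, ℂ)) (n : ι) : ‖ContinuousLinearMap.mul ℂ ℂ (u n)‖ ≤ ‖u‖ := by
  rw [ContinuousLinearMap.opNorm_mul_apply]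
  exact norm_apply_le_norm u n

/-- Pointwise multiplication of square-summable sequences. -/
def siteMul : ℓ²(ι, ℂ) →L[ℂ] ℓ²(ι, ℂ) →L[ℂ] ℓ²(ι, ℂ) :=
  LinearMap.mkContinuous
    { toFun := fun u => lp.mapCLM 2 (fun n => ContinuousLinearMap.mul ℂ ℂ (u n)) (norm_nonneg u)
        (norm_mul_apply_le u)
      map_add' := fun u v => by
        ext w n
        exact add_mul _ _ _
      map_smul' := fun c u => by
        ext w n
        exact mul_assoc _ _ _ }
    1 (fun u => by
      rw [one_mul]
      exact lp.norm_mapCLM_le 2 _ (norm_nonneg u) (norm_mul_apply_le u))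

@[simp]
theorem siteMul_apply (u v : ℓ²(ι, ℂ)) (n : ι) : siteMul u v n = u n * v n := rfl

theorem norm_siteMul_apply_le (u : ℓ²(ι, ℂ)) : ‖siteMul u‖ ≤ ‖u‖ :=
  lp.norm_mapCLM_le 2 _ (norm_nonneg u) (norm_mul_apply_le u)

theorem norm_siteMul_le : ‖(siteMul : ℓ²(ι, ℂ) →L[ℂ] ℓ²(ι, ℂ) →L[ℂ] ℓ²(ι, ℂ))‖ ≤ 1 :=
  LinearMap.mkContinuous_norm_le _ zero_le_one _

theorem siteMul_commute (u v : ℓ²(ι, ℂ)) : Commute (siteMul u) (siteMul v) := by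
  ext w n
  simp [mul_left_comm]

theorem siteMul_pow_apply (a u : ℓ²(ι, ℂ)) (k : ℕ) (n : ι) :
    (siteMul a ^ k) u n = a n ^ k * u n := by
  induction k generalizing u with
  | zero => simp
  | succ k ih => rw [pow_succ, mul_apply_eq_comp, ih, siteMul_apply, pow_succ, mul_assoc]

theorem siteMul_single [DecidableEq ι] (n : ι) (c : ℂ) :
    siteMul (lp.single 2 n c)
      = (c • lp.singleContinuousLinearMap ℂ (fun _ : ι => ℂ) 2 n).comp
        (lp.evalCLM ℂ (fun _ : ι => ℂ) 2 n) := by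
  ext v k
  change (lp.single 2 n c : ℓ²(ι, ℂ)) k * v k = c * (lp.single 2 n (v n) : ℓ²(ι, ℂ)) k
  rcases eq_or_ne k n with rfl | hk
  · rw [lp.single_apply_self, lp.single_apply_self]
  · rw [lp.single_apply_ne _ _ _ hk, lp.single_apply_ne _ _ _ hk, zero_mul, mul_zero]

theorem isCompactOperator_siteMul (u : ℓ²(ι, ℂ)) : IsCompactOperator (siteMul u) := by
  classical
  have hsum := (lp.hasSum_single (by norm_num) u).map siteMul siteMul.continuous
  refine isCompactOperator_of_tendsto hsum (Eventually.of_forall fun s => ?_)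
  refine Finset.sum_induction _ (fun K : ℓ²(ι, ℂ) →L[ℂ] ℓ²(ι, ℂ) => IsCompactOperator K)
    (fun K L hK hL => hK.add hL) isCompactOperator_zero fun n _ => ?_
  rw [Function.comp_apply, siteMul_single]
  exact (isCompactOperator_of_locallyCompactSpace_rng
    (u n • lp.singleContinuousLinearMap ℂ (fun _ : ι => ℂ) 2 n)).comp_clm _

end SiteMultiplication

section FourierSeries

theorem norm_exp_I_mul (m : ℤ) (τ : ℝ) : ‖exp (I * m * τ)‖ = 1 := by
  have : I * m * τ = ((m * τ : ℝ) : ℂ) * I := by push_cast; ring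
  rw [this, norm_exp_ofReal_mul_I]

theorem exp_I_mul_add (j k : ℤ) (τ : ℝ) :
    exp (I * (j + k : ℤ) * τ) = exp (I * j * τ) * exp (I * k * τ) := by
  rw [← exp_add]
  congr 1
  push_cast
  ring

theorem tsum_convolution_mul_exp {u v : ℤ → ℂ} (hu : Summable fun k => ‖u k‖)
    (hv : Summable fun k => ‖v k‖) (τ : ℝ) :
    ∑' m, (∑' k, u k * v (m - k)) * exp (I * m * τ)
      = (∑' k, u k * exp (I * k * τ)) * ∑' k, v k * exp (I * k * τ) := by
  rw [← tsum_tsum_mul_sub (by simpa [norm_exp_I_mul] using hu)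
    (by simpa [norm_exp_I_mul] using hv)]
  refine tsum_congr fun m => ?_
  rw [← tsum_mul_right]
  refine tsum_congr fun k => ?_
  rw [← add_sub_cancel k m, exp_I_mul_add, add_sub_cancel]
  ring

theorem integral_exp_I_mul (j : ℤ) :
    ∫ τ in (-Real.pi)..Real.pi, exp (I * j * τ) = if j = 0 then 2 * (Real.pi : ℂ) else 0 := by
  split_ifs with h
  · subst h
    simp only [Int.cast_zero, mul_zero, zero_mul, exp_zero, intervalIntegral.integral_const,
      sub_neg_eq_add, real_smul, ofReal_add, mul_one]
    ring
  · have hc : I * (j : ℂ) ≠ 0 := mul_ne_zero I_ne_zero (by exact_mod_cast h)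
    have hper : exp (I * j * (Real.pi : ℝ)) = exp (I * j * ((-Real.pi : ℝ) : ℂ)) := by
      rw [exp_eq_exp_iff_exists_int]
      exact ⟨j, by push_cast; ring⟩
    rw [integral_exp_mul_complex hc, hper, sub_self, zero_div]

theorem integral_tsum_mul_exp {c : ℤ → ℂ} (hc : Summable fun k => ‖c k‖) (m : ℤ) :
    ∫ τ in (-Real.pi)..Real.pi, (∑' k, c k * exp (I * k * τ)) * exp (-(I * m * τ))
      = 2 * Real.pi * c m := by
  let f : ℤ → C(ℝ, ℂ) := fun k => ⟨fun τ => c k * exp (I * (k - m : ℤ) * τ), by fun_prop⟩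
  have hf (τ : ℝ) : (∑' k, c k * exp (I * k * τ)) * exp (-(I * m * τ)) = ∑' k, f k τ := by
    rw [← tsum_mul_right]
    refine tsum_congr fun k => ?_
    change _ = c k * exp (I * (k + -m : ℤ) * τ)
    rw [exp_I_mul_add, ← mul_assoc]
    congr 2
    push_cast
    ring
  have hint (k : ℤ) : ∫ τ in (-Real.pi)..Real.pi, f k τ
      = c k * if k - m = 0 then 2 * (Real.pi : ℂ) else 0 := by
    rw [← integral_exp_I_mul]
    exact intervalIntegral.integral_const_mul _ _
  simp_rw [hf]
  rw [← intervalIntegral.tsum_intervalIntegral_eq_of_summable_norm]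
  · rw [tsum_eq_single m fun k hk => by rw [hint, if_neg (sub_ne_zero.mpr hk), mul_zero],
      hint, if_pos (sub_self m), mul_comm]
  · refine hc.of_nonneg_of_le (fun _ => norm_nonneg _) fun k =>
      (ContinuousMap.norm_le _ (norm_nonneg _)).mpr fun τ => ?_
    change ‖c k * exp (I * (k - m : ℤ) * _)‖ ≤ _
    rw [norm_mul, norm_exp_I_mul, mul_one]

end FourierSeries

/-- The weight `1 / (1 + m²)`. Coefficients `B ∈ ℓ^{2,2}` are represented by the weighted sequence
`F ∈ ℓ²`, so that `B m = wt m • F m`. -/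
def wt (m : ℤ) : ℂ := (1 + (m : ℂ) ^ 2)⁻¹

section Weights

theorem one_add_sq_ne_zero (m : ℤ) : (1 + (m : ℂ) ^ 2) ≠ 0 := by
  have : (0 : ℝ) < 1 + (m : ℝ) ^ 2 := by positivity
  exact_mod_cast this.ne'

theorem wt_ne_zero (m : ℤ) : wt m ≠ 0 := inv_ne_zero (one_add_sq_ne_zero m)

theorem wt_neg (m : ℤ) : wt (-m) = wt m := by
  rw [wt, wt, Int.cast_neg, neg_sq]

theorem wt_eq_ofReal (m : ℤ) : wt m = (((1 + (m : ℝ) ^ 2)⁻¹ : ℝ) : ℂ) := by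
  rw [wt]
  push_cast
  rfl

theorem norm_wt (m : ℤ) : ‖wt m‖ = (1 + (m : ℝ) ^ 2)⁻¹ := by
  rw [wt_eq_ofReal, norm_real, Real.norm_of_nonneg (by positivity)]

theorem norm_wt_le_one (m : ℤ) : ‖wt m‖ ≤ 1 := by
  rw [norm_wt]
  exact inv_le_one_of_one_le₀ (by nlinarith [sq_nonneg (m : ℝ)])

theorem summable_norm_wt : Summable fun m : ℤ => ‖wt m‖ := by
  have hne : Summable fun m : ℤ => 1 / (m : ℝ) ^ 2 :=
    Real.summable_one_div_int_pow.mpr one_lt_two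
  have hzero : Summable fun m : ℤ => if m = 0 then (1 : ℝ) else 0 :=
    summable_of_ne_finset_zero (s := {0}) fun m hm => if_neg (by simpa using hm)
  refine (hne.add hzero).of_nonneg_of_le (fun _ => norm_nonneg _) fun m => ?_
  rw [norm_wt]
  split_ifs with h
  · subst h
    simp
  · have : (0 : ℝ) < (m : ℝ) ^ 2 := by positivity
    rw [add_zero, one_div]
    exact inv_anti₀ this (by linarith)

/-- The sum `∑ 1 / (1 + m²)`, a bound for the embedding of `ℓ^{2,2}` into `ℓ¹`. -/
def wtSum : ℝ := ∑' m : ℤ, ‖wt m‖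

theorem wtSum_nonneg : 0 ≤ wtSum := tsum_nonneg fun _ => norm_nonneg _

variable {E : Type*} [NormedAddCommGroup E] [NormedSpace ℂ E]

theorem norm_wt_smul_le_norm_wt_mul (F : ℓ²(ℤ, E)) (m : ℤ) : ‖wt m • F m‖ ≤ ‖wt m‖ * ‖F‖ := by
  rw [norm_smul]
  gcongr
  exact norm_apply_le_norm F m

theorem norm_wt_smul_le (F : ℓ²(ℤ, E)) (m : ℤ) : ‖wt m • F m‖ ≤ ‖F‖ :=
  (norm_wt_smul_le_norm_wt_mul F m).trans
    (mul_le_of_le_one_left (norm_nonneg F) (norm_wt_le_one m))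

theorem summable_norm_wt_smul (F : ℓ²(ℤ, E)) : Summable fun m => ‖wt m • F m‖ :=
  (summable_norm_wt.mul_right ‖F‖).of_nonneg_of_le (fun _ => norm_nonneg _)
    (norm_wt_smul_le_norm_wt_mul F)

theorem tsum_norm_wt_smul_le (F : ℓ²(ℤ, E)) : ∑' m, ‖wt m • F m‖ ≤ wtSum * ‖F‖ := by
  rw [wtSum, ← tsum_mul_right]
  exact (summable_norm_wt_smul F).tsum_le_tsum (norm_wt_smul_le_norm_wt_mul F)
    (summable_norm_wt.mul_right ‖F‖)

/-- The embedding of `ℓ^{2,2}` into `ℓ¹`, in terms of the weighted sequence. -/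
def toL1 : ℓ²(ℤ, E) →L[ℂ] ℓ¹(ℤ, E) :=
  LinearMap.mkContinuous
    { toFun := fun F => ⟨fun m => wt m • F m, by
        apply memℓp_gen
        simpa using summable_norm_wt_smul F⟩
      map_add' := fun F G => lp.ext (funext fun _ => smul_add _ _ _)
      map_smul' := fun c F => lp.ext (funext fun m => smul_comm (wt m) c (F m)) }
    wtSum (fun F => by
      rw [lp.norm_eq_tsum_rpow (by norm_num)]
      simpa using tsum_norm_wt_smul_le F)

/-- The passage from the weighted sequence to the sequence of coefficients. -/
def unweight : ℓ²(ℤ, E) →L[ℂ] ℓ²(ℤ, E) := multiplier wt norm_wt_le_one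

@[simp]
theorem unweight_apply (F : ℓ²(ℤ, E)) (m : ℤ) : unweight F m = wt m • F m := rfl

end Weights

section FourierMultiplication

variable {ι : Type*}

/-- The multiplication by the Fourier series whose weighted sequence of coefficients is given. -/
def fourierMul : ℓ²(ℤ, ℓ²(ι, ℂ)) →L[ℂ] (ℓ²(ℤ, ℓ²(ι, ℂ)) →L[ℂ] ℓ²(ℤ, ℓ²(ι, ℂ))) :=
  modeConv.comp ((lp.mapCLM 1 (fun _ => siteMul) zero_le_one fun _ => norm_siteMul_le).comp toL1)

theorem fourierMul_apply (F H : ℓ²(ℤ, ℓ²(ι, ℂ))) (m : ℤ) (n : ι) :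
    fourierMul F H m n = ∑' k, wt k * F k n * H (m - k) n := by
  have h := hasSum_modeConv_apply
    (lp.mapCLM 1 (fun _ : ℤ => siteMul) zero_le_one (fun _ => norm_siteMul_le) (toL1 F)) H m
  exact (h.mapL (lp.evalCLM ℂ (fun _ : ι => ℂ) 2 n)).tsum_eq.symm

theorem norm_fourierMul_le (F : ℓ²(ℤ, ℓ²(ι, ℂ))) : ‖fourierMul F‖ ≤ ∑' k, ‖wt k • F k‖ := by
  refine (norm_modeConv_le _).trans ?_
  exact (summable_norm_of_l1 _).tsum_le_tsum (fun k => norm_siteMul_apply_le (wt k • F k))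
    (summable_norm_wt_smul F)

theorem fourierMul_commute (F H : ℓ²(ℤ, ℓ²(ι, ℂ))) : Commute (fourierMul F) (fourierMul H) :=
  commute_modeConv fun _ _ => siteMul_commute _ _

theorem fourierMul_unweight_comm (F H : ℓ²(ℤ, ℓ²(ι, ℂ))) :
    fourierMul F (unweight H) = fourierMul H (unweight F) := by
  refine lp.ext (funext fun m => lp.ext (funext fun n => ?_))
  rw [fourierMul_apply, fourierMul_apply, ← (Equiv.subLeft m).tsum_eq]
  refine tsum_congr fun k => ?_
  simp only [Equiv.subLeft_apply, unweight_apply, lp.coeFn_smul, Pi.smul_apply, smul_eq_mul,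
    sub_sub_cancel]
  ring

theorem fourierMul_pow_succ_apply (F H : ℓ²(ℤ, ℓ²(ι, ℂ))) (j : ℕ) :
    (fourierMul F ^ (j + 1)) H = fourierMul F ((fourierMul F ^ j) H) := by
  rw [pow_succ', mul_apply_eq_comp]

theorem summable_norm_site {A : ℤ → ℓ²(ι, ℂ)} (hA : Summable fun k => ‖A k‖) (n : ι) :
    Summable fun k => ‖A k n‖ :=
  hA.of_nonneg_of_le (fun _ => norm_nonneg _) fun k => norm_apply_le_norm (A k) n

theorem summable_norm_fourierMul (F : ℓ²(ℤ, ℓ²(ι, ℂ))) {H : ℓ²(ℤ, ℓ²(ι, ℂ))} {n : ι}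
    (hH : Summable fun m => ‖H m n‖) : Summable fun m => ‖fourierMul F H m n‖ := by
  refine (summable_norm_tsum_mul_sub (u := fun k => wt k * F k n)
    (summable_norm_site (summable_norm_wt_smul F) n) hH).congr fun m => ?_
  rw [fourierMul_apply]

theorem summable_norm_fourierMul_pow_unweight (F H : ℓ²(ℤ, ℓ²(ι, ℂ))) (n : ι) (j : ℕ) :
    Summable fun m => ‖(fourierMul F ^ j) (unweight H) m n‖ := by
  induction j with
  | zero => exact summable_norm_site (summable_norm_wt_smul H) n
  | succ j ih =>
    rw [fourierMul_pow_succ_apply]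
    exact summable_norm_fourierMul F ih

variable {d : ℕ}

theorem fourierSum_fourierMul (F : ℓ²(ℤ, Latt d)) {H : ℓ²(ℤ, Latt d)} {n : Fin d → ℤ}
    (hH : Summable fun m => ‖H m n‖) (τ : ℝ) :
    fourierSum (fun m => fourierMul F H m) n τ
      = fourierSum (fun m => wt m • F m) n τ * fourierSum (fun m => H m) n τ := by
  simp only [fourierSum, fourierMul_apply]
  exact tsum_convolution_mul_exp (summable_norm_site (summable_norm_wt_smul F) n) hH τ

theorem fourierSum_fourierMul_pow_unweight (F H : ℓ²(ℤ, Latt d)) (n : Fin d → ℤ) (j : ℕ) (τ : ℝ) :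
    fourierSum (fun m => (fourierMul F ^ j) (unweight H) m) n τ
      = fourierSum (fun m => wt m • F m) n τ ^ j * fourierSum (fun m => wt m • H m) n τ := by
  induction j with
  | zero => rw [pow_zero (fourierSum _ n τ), one_mul]; rfl
  | succ j ih =>
    rw [fourierMul_pow_succ_apply,
      fourierSum_fourierMul F (summable_norm_fourierMul_pow_unweight F H n j), ih, pow_succ',
      mul_assoc]

theorem integral_fourierSum_pow_mul (F H : ℓ²(ℤ, Latt d)) (j : ℕ) (m : ℤ) (n : Fin d → ℤ) :
    ∫ τ in (-Real.pi)..Real.pi, fourierSum (fun m => wt m • F m) n τ ^ j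
        * fourierSum (fun m => wt m • H m) n τ * exp (-(I * m * τ))
      = 2 * Real.pi * (fourierMul F ^ j) (unweight H) m n := by
  simp_rw [← fourierSum_fourierMul_pow_unweight]
  exact integral_tsum_mul_exp (summable_norm_fourierMul_pow_unweight F H n j) m

theorem hasFDerivAt_fourierMul_pow_unweight (F : ℓ²(ℤ, ℓ²(ι, ℂ))) (j : ℕ) :
    HasFDerivAt (fun H : ℓ²(ℤ, ℓ²(ι, ℂ)) => (fourierMul H ^ j) (unweight H))
      ((j + 1 : ℂ) • (fourierMul F ^ j * unweight)) F := by
  induction j with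
  | zero =>
    rw [Nat.cast_zero, zero_add, one_smul, pow_zero, one_mul]
    exact unweight.hasFDerivAt
  | succ j ih =>
    simp_rw [fourierMul_pow_succ_apply]
    refine (fourierMul.hasFDerivAt (x := F) |>.clm_apply ih).congr_fderiv ?_
    ext1 H
    have hswap : fourierMul H ((fourierMul F ^ j) (unweight F))
        = (fourierMul F ^ (j + 1)) (unweight H) := by
      rw [← mul_apply_eq_comp, ((fourierMul_commute H F).pow_right j).eq, mul_apply_eq_comp,
        fourierMul_unweight_comm, pow_succ, mul_apply_eq_comp]
    simp only [add_apply, ContinuousLinearMap.comp_apply, ContinuousLinearMap.flip_apply,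
      smul_apply, mul_apply_eq_comp, map_smul, hswap, ← fourierMul_pow_succ_apply]
    push_cast
    module

end FourierMultiplication

section Analysis

variable {𝕜 P X Y Z : Type*} [RCLike 𝕜] [NormedAddCommGroup P] [NormedSpace 𝕜 P]
  [NormedAddCommGroup X] [NormedSpace 𝕜 X] [NormedAddCommGroup Y] [NormedSpace 𝕜 Y]
  [NormedAddCommGroup Z] [NormedSpace 𝕜 Z]

theorem isCompactOperator_smulRight (ℓ : X →L[𝕜] 𝕜) (y : Y) :
    IsCompactOperator (ℓ.smulRight y) :=
  (isCompactOperator_of_locallyCompactSpace_rng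
    (ContinuousLinearMap.toSpanSingleton 𝕜 y)).comp_clm ℓ

theorem isUnit_add_of_isCompactOperator [CompleteSpace X] {S K : X →L[𝕜] X}
    (hS : IsUnit S) (hK : IsCompactOperator K) (hinj : ∀ x, S x + K x = 0 → x = 0) :
    IsUnit (S + K) := by
  obtain ⟨s, rfl⟩ := hS
  let K' : X →L[𝕜] X := (↑s⁻¹ : X →L[𝕜] X) * K
  have hK' : IsCompactOperator K' := hK.clm_comp (↑s⁻¹ : X →L[𝕜] X)
  have hsK : (s : X →L[𝕜] X) * K' = K := by simp [K']
  have hfac : (s : X →L[𝕜] X) + K = -(s * (algebraMap 𝕜 _ (-1) - K')) := by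
    rw [mul_sub, hsK]
    simp [add_comm]
  rcases hK'.hasEigenvalue_or_mem_resolventSet (μ := -1) (by norm_num) with h | h
  · obtain ⟨x, hx⟩ := h.exists_hasEigenvector
    refine absurd (hinj x ?_) hx.2
    have h1 : K' x = -x := by simpa using hx.apply_eq_smul
    have h2 : K x = (s : X →L[𝕜] X) (K' x) := by rw [← hsK]; rfl
    rw [h2, h1, map_neg, add_neg_cancel]
  · rw [hfac]
    exact (s.isUnit.mul h).neg

theorem analyticAt_clm_apply {f : X → Y →L[𝕜] Z} {g : X → Y} {x : X} (hf : AnalyticAt 𝕜 f x)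
    (hg : AnalyticAt 𝕜 g x) : AnalyticAt 𝕜 (fun y => f y (g y)) x :=
  AnalyticAt.comp (g := fun q : (Y →L[𝕜] Z) × Y => q.1 q.2) (f := fun y => (f y, g y))
    (ContinuousLinearMap.analyticAt_bilinear (ContinuousLinearMap.id 𝕜 (Y →L[𝕜] Z)) (f x, g x))
    (hf.prod hg)

theorem exists_analytic_implicit [CompleteSpace P] [CompleteSpace X] [CompleteSpace Y]
    {f : P × X → Y} {p₀ : P} {x₀ : X}
    (hf : AnalyticAt 𝕜 f (p₀, x₀)) (h0 : f (p₀, x₀) = 0) {D : X →L[𝕜] Y}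
    (hD : HasFDerivAt (fun x => f (p₀, x)) D x₀) (hbij : Function.Bijective D) :
    ∃ φ : P → X, AnalyticAt 𝕜 φ p₀ ∧ φ p₀ = x₀ ∧
      ∀ᶠ v in 𝓝 (p₀, x₀), f v = 0 ↔ φ v.1 = v.2 := by
  have cdf : ContDiffAt 𝕜 ⊤ f (p₀, x₀) := hf.contDiffAt
  have heq : (fderiv 𝕜 f (p₀, x₀)).comp (ContinuousLinearMap.inr 𝕜 P X) = D :=
    (hf.differentiableAt.hasFDerivAt.comp x₀ (hasFDerivAt_prodMk_right p₀ x₀)).unique hD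
  have hinv : ((fderiv 𝕜 f (p₀, x₀)).comp (ContinuousLinearMap.inr 𝕜 P X)).IsInvertible := by
    rw [heq]
    exact ⟨ContinuousLinearEquiv.ofBijective D (LinearMap.ker_eq_bot.mpr hbij.1)
      (LinearMap.range_eq_top.mpr hbij.2), ContinuousLinearEquiv.coe_ofBijective _ _ _⟩
  refine ⟨cdf.implicitFunction (by simp) hinv,
    (cdf.contDiffAt_implicitFunction (by simp) hinv).analyticAt,
    cdf.implicitFunction_apply_self (by simp) hinv, ?_⟩
  filter_upwards [cdf.eventually_apply_eq_iff_implicitFunction (by simp) hinv] with v hv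
  rw [← hv, h0]

end Analysis

section BorderedOperators

variable {𝕜 P X : Type*} [RCLike 𝕜] [NormedAddCommGroup P] [NormedSpace 𝕜 P]
  [NormedAddCommGroup X] [NormedSpace 𝕜 X]

/-- The solution `y` of the bordered equation `T y + ℓ y • r = r`. Where `T + ℓ • r` is invertible,
`T` is singular exactly when `ℓ y = 1`, and then `y` spans its kernel; where it is not invertible,
the value is `0`. -/
def borderedSolution (T : X →L[𝕜] X) (ℓ : X →L[𝕜] 𝕜) (r : X) : X :=
  Ring.inverse (T + ℓ.smulRight r) r

section

variable {T : X →L[𝕜] X} {ℓ : X →L[𝕜] 𝕜} {r x : X}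

theorem apply_borderedSolution_add (hu : IsUnit (T + ℓ.smulRight r)) :
    T (borderedSolution T ℓ r) + ℓ (borderedSolution T ℓ r) • r = r :=
  congrArg (fun S : X →L[𝕜] X => S r) (Ring.mul_inverse_cancel _ hu)

theorem eq_smul_borderedSolution (hu : IsUnit (T + ℓ.smulRight r)) {c : 𝕜}
    (h : T x + ℓ x • r = c • r) : x = c • borderedSolution T ℓ r := by
  have hx : Ring.inverse (T + ℓ.smulRight r) ((T + ℓ.smulRight r) x) = x :=
    congrArg (fun S : X →L[𝕜] X => S x) (Ring.inverse_mul_cancel _ hu)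
  rw [← hx, add_apply, ContinuousLinearMap.smulRight_apply, h, map_smul,
    borderedSolution]

theorem apply_borderedSolution_eq_zero (hu : IsUnit (T + ℓ.smulRight r))
    (h : ℓ (borderedSolution T ℓ r) = 1) : T (borderedSolution T ℓ r) = 0 := by
  have hr := apply_borderedSolution_add hu
  rwa [h, one_smul, add_eq_right] at hr

theorem eq_smul_borderedSolution_of_apply_eq_zero (hu : IsUnit (T + ℓ.smulRight r))
    (hx : T x = 0) : x = ℓ x • borderedSolution T ℓ r :=
  eq_smul_borderedSolution hu (by rw [hx, zero_add])

theorem apply_borderedSolution_eq_one (hu : IsUnit (T + ℓ.smulRight r)) (hx0 : x ≠ 0)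
    (hx : T x = 0) : ℓ (borderedSolution T ℓ r) = 1 := by
  have h := eq_smul_borderedSolution_of_apply_eq_zero hu hx
  have hℓ : ℓ x ≠ 0 := fun h0 => hx0 (by rw [h, h0, zero_smul])
  have hℓx := congrArg ℓ h
  rw [map_smul, smul_eq_mul] at hℓx
  exact mul_left_cancel₀ hℓ (by rw [← hℓx, mul_one])

end

variable [CompleteSpace X] {ℓ : X →L[𝕜] 𝕜} {r x₀ : X}

theorem analyticAt_borderedSolution {T : P → X →L[𝕜] X} {p₀ : P} (hT : AnalyticAt 𝕜 T p₀)
    (hu : IsUnit (T p₀ + ℓ.smulRight r)) :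
    AnalyticAt 𝕜 (fun q => borderedSolution (T q) ℓ r) p₀ :=
  analyticAt_clm_apply
    (AnalyticAt.comp (g := Ring.inverse) (f := fun q => T q + ℓ.smulRight r)
      (analyticOnNhd_inverse (𝕜 := 𝕜) (A := X →L[𝕜] X) _ hu) (hT.add analyticAt_const))
    analyticAt_const

theorem eventually_isUnit_bordered {Q : Type*} [TopologicalSpace Q] {T : Q → X →L[𝕜] X} {q₀ : Q}
    (hT : ContinuousAt T q₀) (hu : IsUnit (T q₀ + ℓ.smulRight r)) :
    ∀ᶠ q in 𝓝 q₀, IsUnit (T q + ℓ.smulRight r) :=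
  (hT.add continuousAt_const).eventually (Units.isOpen.mem_nhds hu)

theorem hasDerivAt_apply_borderedSolution {T : 𝕜 → X →L[𝕜] X} {σ₀ κ : 𝕜}
    (hT : ContinuousAt T σ₀) (hx₀ : ℓ x₀ = 1) (hTx₀ : ∀ σ, T σ x₀ = (κ * (σ₀ - σ)) • r)
    (hu : IsUnit (T σ₀ + ℓ.smulRight r)) :
    HasDerivAt (fun σ => ℓ (borderedSolution (T σ) ℓ r)) κ σ₀ := by
  have hline : HasDerivAt (fun σ : 𝕜 => 1 + κ * (σ₀ - σ)) (-κ) σ₀ := by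
    simpa using (((hasDerivAt_id σ₀).const_sub σ₀).const_mul κ).const_add 1
  have hinv : HasDerivAt (fun σ : 𝕜 => (1 + κ * (σ₀ - σ))⁻¹) κ σ₀ := by
    simpa using! hline.inv (by simp)
  refine hinv.congr_of_eventuallyEq ?_
  filter_upwards [eventually_isUnit_bordered hT hu] with σ hσ
  have hx : x₀ = (1 + κ * (σ₀ - σ)) • borderedSolution (T σ) ℓ r :=
    eq_smul_borderedSolution hσ (by rw [hTx₀, hx₀, add_comm, add_smul])
  have hℓ := congrArg ℓ hx
  rw [map_smul, hx₀, smul_eq_mul] at hℓ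
  exact (inv_eq_of_mul_eq_one_right hℓ.symm).symm

theorem exists_analytic_eigenpair [CompleteSpace P] {T : P × 𝕜 → X →L[𝕜] X} {p₀ : P} {σ₀ κ : 𝕜}
    (hT : AnalyticAt 𝕜 T (p₀, σ₀)) (hκ : κ ≠ 0) (hx₀ : ℓ x₀ = 1)
    (hTx₀ : ∀ σ, T (p₀, σ) x₀ = (κ * (σ₀ - σ)) • r) (hu : IsUnit (T (p₀, σ₀) + ℓ.smulRight r)) :
    ∃ (s : P → 𝕜) (ψ : P → X), AnalyticAt 𝕜 s p₀ ∧ AnalyticAt 𝕜 ψ p₀ ∧ s p₀ = σ₀ ∧ ψ p₀ = x₀ ∧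
      (∀ᶠ q in 𝓝 p₀, T (q, s q) (ψ q) = 0 ∧ ψ q ≠ 0) ∧
      ∀ᶠ v in 𝓝 (p₀, σ₀), ∀ x, x ≠ 0 → T v x = 0 → v.2 = s v.1 ∧ ∃ c : 𝕜, x = c • ψ v.1 := by
  let y : P × 𝕜 → X := fun v => borderedSolution (T v) ℓ r
  have hy : AnalyticAt 𝕜 y (p₀, σ₀) := analyticAt_borderedSolution hT hu
  have hy₀ : y (p₀, σ₀) = x₀ := by
    have h : x₀ = (1 : 𝕜) • y (p₀, σ₀) :=
      eq_smul_borderedSolution hu (by rw [hTx₀, hx₀, sub_self, mul_zero, zero_smul, zero_add])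
    rw [h, one_smul]
  have hunits := eventually_isUnit_bordered hT.continuousAt hu
  have hderiv : HasDerivAt (fun σ => ℓ (y (p₀, σ)) - 1) κ σ₀ :=
    (hasDerivAt_apply_borderedSolution (T := fun σ => T (p₀, σ))
      (hT.continuousAt.comp (f := fun σ => (p₀, σ)) (by fun_prop)) hx₀ hTx₀ hu).sub_const 1
  have hbij : Function.Bijective (ContinuousLinearMap.toSpanSingleton 𝕜 κ) :=
    Function.bijective_iff_has_inverse.mpr
      ⟨fun z => z / κ, fun z => by simp [hκ], fun z => by simp [hκ]⟩
  obtain ⟨s, hs, hs₀, hzero⟩ := exists_analytic_implicit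
    (((ℓ.analyticAt _).comp hy).sub analyticAt_const) (by simp [hy₀, hx₀])
    hderiv.hasFDerivAt hbij
  have hgraph : AnalyticAt 𝕜 (fun q => (q, s q)) p₀ := analyticAt_id.prod hs
  have htend : Tendsto (fun q => (q, s q)) (𝓝 p₀) (𝓝 (p₀, σ₀)) := hs₀ ▸ hgraph.continuousAt
  refine ⟨s, fun q => y (q, s q), hs, AnalyticAt.comp (g := y) (hs₀.symm ▸ hy) hgraph, hs₀,
    by simp only [hs₀, hy₀], ?_, ?_⟩
  · filter_upwards [htend.eventually hunits, htend.eventually hzero] with q hq hℓ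
    have hy₁ : ℓ (y (q, s q)) = 1 := sub_eq_zero.mp (hℓ.mpr rfl)
    exact ⟨apply_borderedSolution_eq_zero hq hy₁, fun h => by simp [h] at hy₁⟩
  · filter_upwards [hunits, hzero] with v hv hℓ x hx hTx
    have hσ : s v.1 = v.2 :=
      hℓ.mp (sub_eq_zero.mpr (apply_borderedSolution_eq_one hv hx hTx))
    exact ⟨hσ.symm, ℓ x, by
      rw [hσ]
      exact eq_smul_borderedSolution_of_apply_eq_zero hv hTx⟩

end BorderedOperators

theorem exists_eq_smul_of_finrank_maxGenEigenspace_eq_one {K V : Type*} [Field K] [AddCommGroup V]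
    [Module K V] {T : Module.End K V} {z t : K} {b w : V}
    (h : Module.finrank K (T.maxGenEigenspace z) = 1) (hb0 : b ≠ 0) (hb : T b = z • b)
    (hw : T w - z • w = t • b) : ∃ c : K, w = c • b := by
  have hbm : b ∈ T.maxGenEigenspace z :=
    (Module.End.mem_maxGenEigenspace T z b).mpr ⟨1, by
      rw [pow_one]
      exact sub_eq_zero.mpr hb⟩
  have hwm : w ∈ T.maxGenEigenspace z :=
    (Module.End.mem_maxGenEigenspace T z w).mpr ⟨2, by
      rw [pow_two]
      change T (T w - z • w) - z • (T w - z • w) = 0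
      rw [hw, map_smul, hb, smul_comm, sub_self]⟩
  obtain ⟨c, hc⟩ := (finrank_eq_one_iff_of_nonzero' (⟨b, hbm⟩ : T.maxGenEigenspace z)
    (by simpa using hb0)).mp h ⟨w, hwm⟩
  exact ⟨c, (congrArg Subtype.val hc).symm⟩

section LatticeOperators

variable {d : ℕ}

theorem norm_shift_le (v : Fin d → ℤ) : ‖shift v‖ ≤ 1 :=
  LinearMap.mkContinuous_norm_le _ zero_le_one _

theorem norm_lap_add_le : ‖lap d + (2 * d : ℂ) • (1 : Latt d →L[ℂ] Latt d)‖ ≤ 2 * d := by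
  have h : lap d + (2 * d : ℂ) • (1 : Latt d →L[ℂ] Latt d)
      = ∑ j : Fin d, (shift (Pi.single j 1) + shift (-Pi.single j 1)) := by
    rw [lap, Finset.sum_sub_distrib]
    simp only [Finset.sum_const, Finset.card_univ, Fintype.card_fin]
    rw [← Nat.cast_smul_eq_nsmul ℂ, smul_smul, mul_comm (d : ℂ)]
    exact sub_add_cancel _ _
  rw [h]
  refine (norm_sum_le _ _).trans ?_
  refine (Finset.sum_le_card_nsmul _ _ 2 fun j _ => ?_).trans ?_
  · refine (norm_add_le _ _).trans ?_
    linarith [norm_shift_le (Pi.single j 1 : Fin d → ℤ), norm_shift_le (-Pi.single j 1 : Fin d → ℤ)]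
  · simp [mul_comm]

theorem isUnit_smul_one_sub_lap {c : ℝ} (hc : c ∉ Set.Icc (-(4 * d : ℝ)) 0) :
    IsUnit ((c : ℂ) • (1 : Latt d →L[ℂ] Latt d) - lap d) := by
  have hlt : (2 * d : ℝ) < |c + 2 * d| := by
    rw [lt_abs]
    by_contra! h
    exact hc ⟨by linarith, by linarith⟩
  have hmem : ((c + 2 * d : ℝ) : ℂ) ∈
      resolventSet ℂ (lap d + (2 * d : ℂ) • (1 : Latt d →L[ℂ] Latt d)) := by
    refine spectrum.mem_resolventSet_of_norm_lt_mul ?_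
    rw [norm_real, Real.norm_eq_abs]
    refine lt_of_le_of_lt ?_ hlt
    refine (mul_le_of_le_one_right (norm_nonneg _) ContinuousLinearMap.norm_id_le).trans ?_
    exact norm_lap_add_le
  have h : IsUnit _ := hmem
  rw [Algebra.algebraMap_eq_smul_one] at h
  convert h using 1
  push_cast
  rw [add_smul]
  abel

theorem siteMul_pow_eq_mulAbsPow {a : Latt d} (ha : ∀ n, (a n).im = 0) (p : ℕ) :
    siteMul a ^ (2 * p) = mulAbsPow a (2 * p) := by
  ext u n
  change _ = ((‖a n‖ : ℂ) ^ (2 * p)) * u n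
  rw [siteMul_pow_apply, pow_mul, pow_mul, ← ofReal_pow, ← normSq_eq_norm_sq,
    ← mul_conj, conj_eq_iff_im.mpr (ha n), pow_two]

theorem isCompactOperator_mulAbsPow {a : Latt d} (ha : ∀ n, (a n).im = 0) {p : ℕ} (hp : 1 ≤ p) :
    IsCompactOperator (mulAbsPow a (2 * p)) := by
  rw [← siteMul_pow_eq_mulAbsPow ha, ← Nat.sub_add_cancel (show 1 ≤ 2 * p by omega), pow_succ']
  exact (isCompactOperator_siteMul a).comp_clm _

end LatticeOperators

section PairOperators

variable {E : Type*} [NormedAddCommGroup E] [NormedSpace ℂ E]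

/-- The interaction `(x, y) ↦ (α S x + β S y, α S y + β S x)` of two modes through a potential
`S`. -/
def pairPot (S : E →L[ℂ] E) (α β : ℂ) : (E × E) →L[ℂ] (E × E) :=
  (S.comp (α • ContinuousLinearMap.fst ℂ E E + β • ContinuousLinearMap.snd ℂ E E)).prod
    (S.comp (α • ContinuousLinearMap.snd ℂ E E + β • ContinuousLinearMap.fst ℂ E E))

theorem pairPot_apply (S : E →L[ℂ] E) (α β : ℂ) (z : E × E) :
    pairPot S α β z = (α • S z.1 + β • S z.2, α • S z.2 + β • S z.1) := by
  simp [pairPot]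

theorem isCompactOperator_pairPot {S : E →L[ℂ] E} (hS : IsCompactOperator S) (α β : ℂ) :
    IsCompactOperator (pairPot S α β) := by
  have hsplit : pairPot S α β
      = ((ContinuousLinearMap.inl ℂ E E).comp S).comp
          (α • ContinuousLinearMap.fst ℂ E E + β • ContinuousLinearMap.snd ℂ E E)
        + ((ContinuousLinearMap.inr ℂ E E).comp S).comp
          (α • ContinuousLinearMap.snd ℂ E E + β • ContinuousLinearMap.fst ℂ E E) := by
    ext z <;> simp [pairPot]
  rw [hsplit]
  exact ((hS.clm_comp (ContinuousLinearMap.inl ℂ E E)).comp_clm _).add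
    ((hS.clm_comp (ContinuousLinearMap.inr ℂ E E)).comp_clm _)

/-- The change of variables `(b₊, b₋) ↦ (b₊ + i b₋, b₊ - i b₋)` from the real and imaginary parts
of a dNLS perturbation to its Fourier modes `±1`. -/
def polarize (b : E × E) : E × E := (b.1 + I • b.2, b.1 - I • b.2)

/-- The map `(u₁, u₂) ↦ (u₂ - i u₁, u₂ + i u₁)`, which intertwines `linNLS` with the spectral
problem for the modes `±1`. -/
def copolarize (u : E × E) : E × E := (u.2 - I • u.1, u.2 + I • u.1)

theorem exists_polarize_eq (z : E × E) : ∃ b, polarize b = z := by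
  refine ⟨((1 / 2 : ℂ) • (z.1 + z.2), (-(I / 2)) • (z.1 - z.2)), ?_⟩
  have hI : I * -(I / 2) = 1 / 2 := by linear_combination (-1 / 2 : ℂ) * I_mul_I
  refine Prod.ext ?_ ?_ <;> simp only [polarize, smul_smul, hI] <;> module

theorem polarize_smul (c : ℂ) (b : E × E) : polarize (c • b) = c • polarize b :=
  Prod.ext (by simp only [polarize, Prod.smul_fst, Prod.smul_snd]; module)
    (by simp only [polarize, Prod.smul_fst, Prod.smul_snd]; module)

theorem copolarize_smul (c : ℂ) (u : E × E) : copolarize (c • u) = c • copolarize u :=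
  Prod.ext
    (by simp only [copolarize, Prod.smul_fst, Prod.smul_snd]; module)
    (by simp only [copolarize, Prod.smul_fst, Prod.smul_snd]; module)

theorem copolarize_add_smul (c : ℂ) (u v : E × E) :
    copolarize (u + c • v) = copolarize u + c • copolarize v :=
  Prod.ext
    (by simp only [copolarize, Prod.fst_add, Prod.snd_add, Prod.smul_fst, Prod.smul_snd]; module)
    (by simp only [copolarize, Prod.fst_add, Prod.snd_add, Prod.smul_fst, Prod.smul_snd]; module)

theorem eq_zero_of_add_I_smul_eq_zero {x y : E} (h₁ : x + I • y = 0) (h₂ : x - I • y = 0) :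
    x = 0 ∧ y = 0 := by
  have hx : (2 : ℂ) • x = 0 := by linear_combination (norm := module) h₁ + h₂
  have hy : (2 * I) • y = 0 := by linear_combination (norm := module) h₁ - h₂
  exact ⟨(smul_eq_zero_iff_right two_ne_zero).mp hx,
    (smul_eq_zero_iff_right (mul_ne_zero two_ne_zero I_ne_zero)).mp hy⟩

theorem polarize_ne_zero {b : E × E} (hb : b ≠ 0) : polarize b ≠ 0 := fun h =>
  have hxy := eq_zero_of_add_I_smul_eq_zero (congrArg Prod.fst h) (congrArg Prod.snd h)
  hb (Prod.ext hxy.1 hxy.2)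

theorem eq_zero_of_copolarize_eq_zero {u : E × E} (hu : copolarize u = 0) : u = 0 :=
  have hxy := eq_zero_of_add_I_smul_eq_zero (congrArg Prod.snd hu) (congrArg Prod.fst hu)
  Prod.ext hxy.2 hxy.1

end PairOperators

section PairProblem

variable {d : ℕ} {p : ℕ} {Ω : ℝ} {a : Latt d}

/-- The diagonal part of `pairOp`, which does not involve the soliton. -/
def pairDiag (d : ℕ) (Ω : ℝ) (σ : ℂ) : (Latt d × Latt d) →L[ℂ] (Latt d × Latt d) :=
  ((Ω + 2 * I * σ) • (1 : Latt d →L[ℂ] Latt d) - lap d).prodMap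
    ((Ω - 2 * I * σ) • (1 : Latt d →L[ℂ] Latt d) - lap d)

theorem pairDiag_apply (d : ℕ) (Ω : ℝ) (σ : ℂ) (z : Latt d × Latt d) :
    pairDiag d Ω σ z
      = ((Ω + 2 * I * σ) • z.1 - lap d z.1, (Ω - 2 * I * σ) • z.2 - lap d z.2) := rfl

theorem isUnit_pairDiag {σ : ℂ} (hσ : σ.re = 0)
    (h₁ : Ω - 2 * σ.im ∉ Set.Icc (-(4 * d : ℝ)) 0) (h₂ : Ω + 2 * σ.im ∉ Set.Icc (-(4 * d : ℝ)) 0) :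
    IsUnit (pairDiag d Ω σ) := by
  have hσI : I * σ = -σ.im := by
    apply Complex.ext <;> simp [hσ]
  have e₁ : (Ω : ℂ) + 2 * I * σ = ((Ω - 2 * σ.im : ℝ) : ℂ) := by
    push_cast
    linear_combination 2 * hσI
  have e₂ : (Ω : ℂ) - 2 * I * σ = ((Ω + 2 * σ.im : ℝ) : ℂ) := by
    push_cast
    linear_combination -2 * hσI
  rw [ContinuousLinearMap.isUnit_iff_bijective, pairDiag, e₁, e₂]
  exact (ContinuousLinearMap.isUnit_iff_bijective.mp (isUnit_smul_one_sub_lap h₁)).prodMap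
    (ContinuousLinearMap.isUnit_iff_bijective.mp (isUnit_smul_one_sub_lap h₂))

/-- The coefficient of `|a|^{2p} B^{(±1)}` in the equation for the mode `±1`: it is `1 + 2p` times
the zeroth Fourier coefficient of `(e^{iτ} + e^{-iτ})^{2p}`. -/
def selfCoeff (p : ℕ) : ℂ := (1 + 2 * p) * ((2 * p).choose p : ℂ)

/-- The coefficient of `|a|^{2p} B^{(∓1)}` in the equation for the mode `±1`: it is `1 + 2p` times
the second Fourier coefficient of `(e^{iτ} + e^{-iτ})^{2p}`. -/
def crossCoeff (p : ℕ) : ℂ := (1 + 2 * p) * ((2 * p).choose (p + 1) : ℂ)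

theorem selfCoeff_add_crossCoeff (p : ℕ) :
    selfCoeff p + crossCoeff p = (((1 + 2 * p) * gam p : ℝ) : ℂ) := by
  have h : (1 + 2 * p).choose (1 + p) = (2 * p).choose p + (2 * p).choose (p + 1) := by
    rw [add_comm 1 (2 * p), add_comm 1 p, Nat.choose_succ_succ]
  rw [selfCoeff, crossCoeff, gam, h]
  push_cast
  ring

theorem selfCoeff_sub_crossCoeff (p : ℕ) : selfCoeff p - crossCoeff p = gam p := by
  have hgam : ((2 * p + 1 : ℕ) : ℂ) * ((2 * p).choose p : ℂ)
      = ((1 + 2 * p).choose (1 + p) : ℂ) * ((p + 1 : ℕ) : ℂ) := by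
    rw [add_comm 1 (2 * p), add_comm 1 p]
    exact_mod_cast Nat.add_one_mul_choose_eq (2 * p) p
  have hcross : ((2 * p).choose (p + 1) : ℂ) * ((p + 1 : ℕ) : ℂ)
      = ((2 * p).choose p : ℂ) * p := by
    have h := Nat.choose_succ_right_eq (2 * p) p
    rw [show 2 * p - p = p by omega] at h
    exact_mod_cast h
  have hp : ((p + 1 : ℕ) : ℂ) ≠ 0 := by exact_mod_cast Nat.succ_ne_zero p
  apply mul_right_cancel₀ hp
  rw [selfCoeff, crossCoeff, gam]
  push_cast at *
  linear_combination (1 + 2 * (p : ℂ)) * (-hcross) + hgam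

/-- The spectral problem for the modes `±1` in the limit `ε → 0`, at the eigenvalue `σ`. -/
def pairOp (p : ℕ) (Ω : ℝ) (a : Latt d) (σ : ℂ) : (Latt d × Latt d) →L[ℂ] (Latt d × Latt d) :=
  pairDiag d Ω σ + pairPot (mulAbsPow a (2 * p)) (selfCoeff p) (crossCoeff p)

theorem pairOp_polarize (p : ℕ) (Ω : ℝ) (a : Latt d) (σ : ℂ) (b : Latt d × Latt d) :
    pairOp p Ω a σ (polarize b) = copolarize (linNLS p Ω a b - (2 * σ) • b) := by
  obtain ⟨b₁, b₂⟩ := b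
  have hlin : linNLS p Ω a (b₁, b₂) = (-(schr p Ω 1 a b₂), jac p Ω a b₁) := rfl
  have hschr : ∀ (c : ℝ) (x : Latt d), schr p Ω c a x
      = (Ω : ℂ) • x - lap d x + ((c * gam p : ℝ) : ℂ) • mulAbsPow a (2 * p) x := fun _ _ => rfl
  rw [hlin, jac, hschr, hschr, one_mul, ← selfCoeff_add_crossCoeff, ← selfCoeff_sub_crossCoeff,
    pairOp, add_apply, polarize, pairDiag_apply, pairPot_apply]
  simp only [copolarize, map_add, map_sub, map_smul]
  generalize mulAbsPow a (2 * p) b₁ = s₁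
  generalize mulAbsPow a (2 * p) b₂ = s₂
  generalize lap d b₁ = l₁
  generalize lap d b₂ = l₂
  refine Prod.ext ?_ ?_
  · simp only [Prod.fst_add, Prod.fst_sub, Prod.snd_sub, Prod.smul_fst, Prod.smul_snd]
    linear_combination (norm := module) (2 * σ * I_mul_I) • b₂
  · simp only [Prod.snd_add, Prod.fst_sub, Prod.snd_sub, Prod.smul_fst, Prod.smul_snd]
    linear_combination (norm := module) (2 * σ * I_mul_I) • b₂

theorem pairOp_add_smulRight_injective {Λ : ℂ}
    (hΛ : Module.finrank ℂ (Module.End.maxGenEigenspace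
      (linNLS p Ω a : (Latt d × Latt d) →ₗ[ℂ] (Latt d × Latt d)) (2 * Λ)) = 1)
    {b : Latt d × Latt d} (hb0 : b ≠ 0) (hb : linNLS p Ω a b = (2 * Λ) • b)
    {ℓ : (Latt d × Latt d) →L[ℂ] ℂ} (hℓ : ℓ (polarize b) = 1) (z : Latt d × Latt d)
    (hz : pairOp p Ω a Λ z + ℓ.smulRight (copolarize b) z = 0) : z = 0 := by
  obtain ⟨w, rfl⟩ := exists_polarize_eq z
  rw [pairOp_polarize, ContinuousLinearMap.smulRight_apply, ← copolarize_add_smul] at hz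
  have h := eq_zero_of_copolarize_eq_zero hz
  obtain ⟨c, rfl⟩ := exists_eq_smul_of_finrank_maxGenEigenspace_eq_one hΛ hb0 hb
    (t := -ℓ (polarize w)) (w := w) (by
      rw [neg_smul]
      exact eq_neg_of_add_eq_zero_left h)
  rw [map_smul, hb, smul_comm, sub_self, zero_add, polarize_smul, map_smul, hℓ] at h
  have hc : c = 0 := by simpa [hb0] using h
  rw [hc, polarize_smul, zero_smul]

/-- A correction of `pairOp p Ω a 0` on odd sequences. There `pairOp p Ω a 0` acts as
`Ω - Δ + γ_p |a|^{2p}`, whose kernel contains `a`; the correction removes the potential and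
leaves `Ω - Δ`. -/
def oddCorrection (p : ℕ) (a : Latt d) : (Latt d × Latt d) →L[ℂ] (Latt d × Latt d) :=
  pairPot (mulAbsPow a (2 * p)) (-(gam p : ℂ) / 2) ((gam p : ℂ) / 2)

theorem pairOp_zero_add_oddCorrection_polarize (p : ℕ) (Ω : ℝ) (a : Latt d) (b : Latt d × Latt d) :
    pairOp p Ω a 0 (polarize b) + oddCorrection p a (polarize b)
      = copolarize (-((Ω : ℂ) • b.2 - lap d b.2), jac p Ω a b.1) := by
  have hschr : schr p Ω 1 a b.2
      = (Ω : ℂ) • b.2 - lap d b.2 + (gam p : ℂ) • mulAbsPow a (2 * p) b.2 := by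
    rw [schr, one_mul]
    rfl
  have hlin : linNLS p Ω a b = (-(schr p Ω 1 a b.2), jac p Ω a b.1) := rfl
  rw [pairOp_polarize, mul_zero, zero_smul, sub_zero, hlin, hschr, polarize, oddCorrection,
    pairPot_apply]
  simp only [map_add, map_sub, map_smul, copolarize]
  refine Prod.ext ?_ ?_
  · simp only [Prod.fst_add]
    module
  · simp only [Prod.snd_add]
    module

theorem pairOp_add_oddCorrection_injective (hΩ : Ω ∉ Set.Icc (-(4 * d : ℝ)) 0)
    (hJ : ∀ v : Latt d, jac p Ω a v = 0 → v = 0) (z : Latt d × Latt d)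
    (hz : pairOp p Ω a 0 z + oddCorrection p a z = 0) : z = 0 := by
  obtain ⟨b, rfl⟩ := exists_polarize_eq z
  rw [pairOp_zero_add_oddCorrection_polarize] at hz
  have h := eq_zero_of_copolarize_eq_zero hz
  have hb₁ : b.1 = 0 := hJ b.1 (congrArg Prod.snd h)
  have hb₂ : b.2 = 0 := by
    refine (ContinuousLinearMap.isUnit_iff_bijective.mp (isUnit_smul_one_sub_lap hΩ)).1 ?_
    rw [map_zero]
    exact neg_eq_zero.mp (congrArg Prod.fst h)
  simp [polarize, hb₁, hb₂]

end PairProblem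

section PairEmbedding

variable {E : Type*} [NormedAddCommGroup E] [NormedSpace ℂ E]

/-- The entries with indices `±1` of an unweighted sequence. -/
def pairOut : ℓ²(ℤ, E) →L[ℂ] E × E :=
  (wt 1 • lp.evalCLM ℂ (fun _ : ℤ => E) 2 1).prod (wt (-1) • lp.evalCLM ℂ (fun _ : ℤ => E) 2 (-1))

theorem pairOut_apply (F : ℓ²(ℤ, E)) : pairOut F = (wt 1 • F 1, wt (-1) • F (-1)) := rfl

/-- The sequence with given entries at the indices `±1` and zero elsewhere. -/
def pairIn : E × E →L[ℂ] ℓ²(ℤ, E) :=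
  (lp.singleContinuousLinearMap ℂ (fun _ : ℤ => E) 2 1).coprod
    (lp.singleContinuousLinearMap ℂ (fun _ : ℤ => E) 2 (-1))

theorem pairIn_apply (z : E × E) (m : ℤ) :
    pairIn z m = (if m = 1 then z.1 else 0) + (if m = -1 then z.2 else 0) := by
  change (lp.single 2 1 z.1 : ℓ²(ℤ, E)) m + (lp.single 2 (-1) z.2 : ℓ²(ℤ, E)) m = _
  rw [lp.single_apply, lp.single_apply, Pi.single_apply, Pi.single_apply]

@[simp]
theorem pairIn_one (z : E × E) : pairIn z 1 = z.1 := by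
  rw [pairIn_apply, if_pos rfl, if_neg (by norm_num), add_zero]

@[simp]
theorem pairIn_neg_one (z : E × E) : pairIn z (-1) = z.2 := by
  rw [pairIn_apply, if_pos rfl, if_neg (by norm_num), zero_add]

theorem pairIn_far (z : E × E) {m : ℤ} (hm : ¬(m = 1 ∨ m = -1)) : pairIn z m = 0 := by
  rw [not_or] at hm
  rw [pairIn_apply, if_neg hm.1, if_neg hm.2, add_zero]

theorem pairIn_injective : Function.Injective (pairIn : E × E → ℓ²(ℤ, E)) := fun z w h =>
  Prod.ext (by rw [← pairIn_one z, h, pairIn_one]) (by rw [← pairIn_neg_one z, h, pairIn_neg_one])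

theorem eq_pairIn {F : ℓ²(ℤ, E)} (hF : ∀ m, ¬(m = 1 ∨ m = -1) → F m = 0) :
    F = pairIn (F 1, F (-1)) := by
  refine lp.ext (funext fun m => ?_)
  by_cases hm : m = 1 ∨ m = -1
  · rcases hm with rfl | rfl <;> simp
  · rw [hF m hm, pairIn_far _ hm]

theorem wt_one : wt 1 = 1 / 2 := by
  rw [wt]
  norm_num

theorem wt_neg_one : wt (-1) = 1 / 2 := by
  rw [wt_neg, wt_one]

theorem unweight_two_smul_pairIn (z : E × E) : unweight ((2 : ℂ) • pairIn z) = pairIn z := by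
  refine lp.ext (funext fun m => ?_)
  rw [unweight_apply, lp.coeFn_smul, Pi.smul_apply, smul_smul]
  by_cases hm : m = 1 ∨ m = -1
  · have hwt : wt m * 2 = 1 := by
      rcases hm with rfl | rfl
      · norm_num [wt_one]
      · norm_num [wt_neg_one]
    rw [hwt, one_smul]
  · rw [pairIn_far _ hm, smul_zero]

theorem pairOut_two_smul_pairIn (z : E × E) : pairOut ((2 : ℂ) • pairIn z) = z := by
  rw [map_smul, pairOut_apply, pairIn_one, pairIn_neg_one, wt_one, wt_neg_one]
  refine Prod.ext ?_ ?_ <;> simp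

theorem mapModes_pairIn (K : E →L[ℂ] E) (z : E × E) :
    mapModes K (pairIn z) = pairIn (K z.1, K z.2) := by
  refine lp.ext (funext fun m => ?_)
  rw [mapModes_apply, pairIn_apply, pairIn_apply, map_add, apply_ite K, apply_ite K, map_zero]

theorem bijective_of_pair_block {D : ℓ²(ℤ, E) →L[ℂ] ℓ²(ℤ, E)} {f : ℤ → ℂ} {C : ℝ} {c : ℂ}
    {M : E × E →L[ℂ] E × E} (hc : c ≠ 0)
    (hfar : ∀ F m, ¬(m = 1 ∨ m = -1) → D F m = f m • F m)
    (hf : ∀ m, ¬(m = 1 ∨ m = -1) → f m ≠ 0) (hfC : ∀ m, ‖(f m)⁻¹‖ ≤ C)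
    (hpair : ∀ z, D (c • pairIn z) = pairIn (M z)) (hM : Function.Bijective M) :
    Function.Bijective D := by
  refine ⟨(injective_iff_map_eq_zero D).mpr fun F hF => ?_, fun G => ?_⟩
  · have hFpair : F = c • pairIn (c⁻¹ • (F 1, F (-1))) := by
      rw [map_smul, smul_smul, mul_inv_cancel₀ hc, one_smul]
      refine eq_pairIn fun m hm => ?_
      have h := hfar F m hm
      rw [hF] at h
      exact (smul_eq_zero_iff_right (hf m hm)).mp h.symm
    have hz : M (c⁻¹ • (F 1, F (-1))) = M 0 := pairIn_injective (by
      rw [← hpair, ← hFpair, hF, map_zero, map_zero])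
    rw [hFpair, hM.1 hz, map_zero, smul_zero]
  · let H : ℓ²(ℤ, E) := multiplier (fun m => (f m)⁻¹) hfC G
    have hH : ∀ m, ¬(m = 1 ∨ m = -1) → (G - D H) m = 0 := fun m hm => by
      rw [lp.coeFn_sub, Pi.sub_apply, hfar H m hm, multiplier_apply, smul_smul,
        mul_inv_cancel₀ (hf m hm), one_smul, sub_self]
    obtain ⟨z, hz⟩ := hM.2 ((G - D H) 1, (G - D H) (-1))
    exact ⟨H + c • pairIn z, by rw [map_add, hpair, hz, ← eq_pairIn hH, add_sub_cancel]⟩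

theorem modeShift_add_pow_apply (N : ℕ) (F : ℓ²(ℤ, E)) (m : ℤ) :
    (((modeShift 1 + modeShift (-1)) ^ N : ℓ²(ℤ, E) →L[ℂ] ℓ²(ℤ, E)) F) m
      = ∑ j ∈ Finset.range (N + 1), (N.choose j : ℂ) • F (m - (2 * j - N)) := by
  have hcomm : Commute (modeShift 1 : ℓ²(ℤ, E) →L[ℂ] ℓ²(ℤ, E)) (modeShift (-1)) := by
    rw [Commute, SemiconjBy, modeShift_mul, modeShift_mul, add_comm]
  rw [hcomm.add_pow, sum_apply, lp.coeFn_sum, Finset.sum_apply]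
  refine Finset.sum_congr rfl fun j hj => ?_
  rw [modeShift_pow, modeShift_pow, modeShift_mul, ← nsmul_eq_mul', ← Nat.cast_smul_eq_nsmul ℂ,
    smul_apply, lp.coeFn_smul, Pi.smul_apply, modeShift_apply]
  have hjN : j ≤ N := Nat.lt_succ_iff.mp (Finset.mem_range.mp hj)
  have hshift : j • (1 : ℤ) + (N - j) • (-1 : ℤ) = 2 * j - N := by
    rw [nsmul_eq_mul, nsmul_eq_mul, Nat.cast_sub hjN]
    ring
  rw [hshift]

theorem modeShift_add_pow_pairIn_one (p : ℕ) (z : E × E) :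
    (((modeShift 1 + modeShift (-1)) ^ (2 * p) : ℓ²(ℤ, E) →L[ℂ] ℓ²(ℤ, E)) (pairIn z)) 1
      = ((2 * p).choose p : ℂ) • z.1 + ((2 * p).choose (p + 1) : ℂ) • z.2 := by
  have hself : ∀ j : ℕ, (1 - (2 * (j : ℤ) - (2 * p : ℕ)) = 1) ↔ j = p := fun j => by omega
  have hcross : ∀ j : ℕ, (1 - (2 * (j : ℤ) - (2 * p : ℕ)) = -1) ↔ j = p + 1 := fun j => by omega
  rw [modeShift_add_pow_apply]
  simp only [pairIn_apply, hself, hcross, smul_add, smul_ite, smul_zero, Finset.sum_add_distrib,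
    Finset.sum_ite_eq', Finset.mem_range]
  rw [if_pos (by omega)]
  congr 1
  split_ifs with h
  · rfl
  · rw [Nat.choose_eq_zero_of_lt (by omega), Nat.cast_zero, zero_smul]

theorem modeShift_add_pow_pairIn_neg_one {p : ℕ} (hp : 1 ≤ p) (z : E × E) :
    (((modeShift 1 + modeShift (-1)) ^ (2 * p) : ℓ²(ℤ, E) →L[ℂ] ℓ²(ℤ, E)) (pairIn z)) (-1)
      = ((2 * p).choose p : ℂ) • z.2 + ((2 * p).choose (p + 1) : ℂ) • z.1 := by
  have hcross : ∀ j : ℕ, (-1 - (2 * (j : ℤ) - (2 * p : ℕ)) = 1) ↔ j = p - 1 := fun j => by omega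
  have hself : ∀ j : ℕ, (-1 - (2 * (j : ℤ) - (2 * p : ℕ)) = -1) ↔ j = p := fun j => by omega
  have hchoose : (2 * p).choose (p - 1) = (2 * p).choose (p + 1) :=
    Nat.choose_symm_of_eq_add (by omega)
  rw [modeShift_add_pow_apply]
  simp only [pairIn_apply, hself, hcross, smul_add, smul_ite, smul_zero, Finset.sum_add_distrib,
    Finset.sum_ite_eq', Finset.mem_range]
  rw [if_pos (by omega), if_pos (by omega), hchoose, add_comm]

end PairEmbedding

section RescaledOperator

variable {d : ℕ}

theorem norm_mul_wt_le (m : ℤ) : ‖(m : ℂ) * wt m‖ ≤ 2 := by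
  rw [norm_mul, norm_wt, norm_intCast, ← div_eq_mul_inv, div_le_iff₀ (by positivity)]
  nlinarith [sq_abs (m : ℝ), sq_nonneg (|(m : ℝ)| - 1)]

theorem norm_sq_mul_wt_le (m : ℤ) : ‖(m : ℂ) ^ 2 * wt m‖ ≤ 2 := by
  rw [norm_mul, norm_wt, norm_pow, norm_intCast, sq_abs, ← div_eq_mul_inv,
    div_le_iff₀ (by positivity)]
  nlinarith [sq_nonneg (m : ℝ)]

/-- The space `ℓ²(ℤ; ℓ²(ℤ^d))`, which carries the weighted sequences `weighted B` of the elements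
`B` of `ℓ^{2,2}`. -/
abbrev Modes (d : ℕ) : Type := ℓ²(ℤ, Latt d)

/-- The multiplier with symbol `m / (1 + m²)`. -/
def unweightDeriv : Modes d →L[ℂ] Modes d := multiplier (fun m => m * wt m) norm_mul_wt_le

/-- The multiplier with symbol `m² / (1 + m²)`. -/
def unweightDerivSq : Modes d →L[ℂ] Modes d :=
  multiplier (fun m => m ^ 2 * wt m) norm_sq_mul_wt_le

/-- The projection to the Fourier modes `±1`. -/
def near : Modes d →L[ℂ] Modes d :=
  multiplier (C := 1) (fun m => if m = 1 ∨ m = -1 then 1 else 0) fun m => by split_ifs <;> simp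

/-- The projection to the Fourier modes other than `±1`. -/
def far : Modes d →L[ℂ] Modes d :=
  multiplier (C := 1) (fun m => if m = 1 ∨ m = -1 then 0 else 1) fun m => by split_ifs <;> simp

theorem near_apply (F : Modes d) (m : ℤ) : near F m = if m = 1 ∨ m = -1 then F m else 0 := by
  rw [near, multiplier_apply, ite_smul, one_smul, zero_smul]

theorem far_apply (F : Modes d) (m : ℤ) : far F m = if m = 1 ∨ m = -1 then 0 else F m := by
  rw [far, multiplier_apply, ite_smul, one_smul, zero_smul]

/-- The operator of the dKG spectral problem in the weighted variables, for the eigenvalue `ε σ`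
and the potential `V`. The equations for the modes `±1`, where `1 - m² ω²` is of order `ε`, are
divided by `ε`; there `θ` stands for `(1 - ω²) / ε`, so that `ε = 0` is a regular point. -/
def kgOp (ε ω θ σ : ℂ) (V : Modes d →L[ℂ] Modes d) : Modes d →L[ℂ] Modes d :=
  let S : Modes d →L[ℂ] Modes d := unweight
  let W : Modes d →L[ℂ] Modes d := (V - mapModes (lap d)) * S
  far * ((1 + ε ^ 2 * σ ^ 2) • S + (2 * I * ε * σ * ω) • unweightDeriv
      - ω ^ 2 • unweightDerivSq + ε • W)
    + near * ((θ + ε * σ ^ 2) • S + (2 * I * ω * σ) • unweightDeriv + W)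

theorem kgOp_apply_far (ε ω θ σ : ℂ) (V : Modes d →L[ℂ] Modes d) (F : Modes d) {m : ℤ}
    (hm : ¬(m = 1 ∨ m = -1)) :
    kgOp ε ω θ σ V F m = (1 + (ε * σ + I * m * ω) ^ 2) • wt m • F m + ε • V (unweight F) m
      - ε • lap d (wt m • F m) := by
  have h : kgOp ε ω θ σ V F m = (1 + ε ^ 2 * σ ^ 2) • wt m • F m
      + (2 * I * ε * σ * ω) • ((m : ℂ) * wt m) • F m - ω ^ 2 • ((m : ℂ) ^ 2 * wt m) • F m
      + ε • (V (unweight F) m - lap d (wt m • F m)) := by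
    rw [kgOp, add_apply, lp.coeFn_add, Pi.add_apply, mul_apply_eq_comp, mul_apply_eq_comp,
      near_apply, if_neg hm, far_apply, if_neg hm, add_zero]
    rfl
  rw [h]
  linear_combination (norm := module) (-(m : ℂ) ^ 2 * ω ^ 2 * wt m * I_mul_I) • F m

theorem kgOp_apply_near (ε ω θ σ : ℂ) (V : Modes d →L[ℂ] Modes d) (F : Modes d) {m : ℤ}
    (hm : m = 1 ∨ m = -1) :
    kgOp ε ω θ σ V F m = (θ + ε * σ ^ 2 + 2 * I * ω * σ * m) • wt m • F m + V (unweight F) m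
      - lap d (wt m • F m) := by
  have h : kgOp ε ω θ σ V F m = (θ + ε * σ ^ 2) • wt m • F m
      + (2 * I * ω * σ) • ((m : ℂ) * wt m) • F m
      + (V (unweight F) m - lap d (wt m • F m)) := by
    rw [kgOp, add_apply, lp.coeFn_add, Pi.add_apply, mul_apply_eq_comp, mul_apply_eq_comp,
      near_apply, if_pos hm, far_apply, if_pos hm, zero_add]
    rfl
  rw [h]
  module

theorem analyticAt_kgOp {X : Type*} [NormedAddCommGroup X] [NormedSpace ℂ X]
    {ε ω θ σ : X → ℂ} {V : X → Modes d →L[ℂ] Modes d} {x : X} (hε : AnalyticAt ℂ ε x)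
    (hω : AnalyticAt ℂ ω x) (hθ : AnalyticAt ℂ θ x) (hσ : AnalyticAt ℂ σ x)
    (hV : AnalyticAt ℂ V x) :
    AnalyticAt ℂ (fun y => kgOp (ε y) (ω y) (θ y) (σ y) (V y)) x := by
  have hVL : AnalyticAt ℂ (fun y => (V y - mapModes (lap d)) * unweight) x :=
    (hV.sub analyticAt_const).mul analyticAt_const
  have hs : ∀ {c : X → ℂ}, AnalyticAt ℂ c x → ∀ K : Modes d →L[ℂ] Modes d,
      AnalyticAt ℂ (fun y => c y • K) x := fun hc _ => hc.smul analyticAt_const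
  unfold kgOp
  refine (analyticAt_const.mul ?_).add (analyticAt_const.mul ?_)
  · refine ((AnalyticAt.add ?_ ?_).sub ?_).add (hε.smul hVL)
    · exact hs (by fun_prop) _
    · exact hs (by fun_prop) _
    · exact hs (by fun_prop) _
  · refine (AnalyticAt.add ?_ ?_).add hVL
    · exact hs (by fun_prop) _
    · exact hs (by fun_prop) _

theorem smul_kgOp_apply {ε ω θ σ : ℂ} (hθ : ε * θ = 1 - ω ^ 2) (V : Modes d →L[ℂ] Modes d)
    (F : Modes d) {m : ℤ} (hm : m = 1 ∨ m = -1) :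
    ε • kgOp ε ω θ σ V F m = (1 + (ε * σ + I * m * ω) ^ 2) • wt m • F m + ε • V (unweight F) m
      - ε • lap d (wt m • F m) := by
  have hm2 : (m : ℂ) ^ 2 = 1 := by
    rcases hm with rfl | rfl <;> norm_num
  have hcoeff : (1 + (ε * σ + I * m * ω) ^ 2 : ℂ)
      = ε * (θ + ε * σ ^ 2 + 2 * I * ω * σ * m) := by
    linear_combination (-1 : ℂ) * hθ - ω ^ 2 * hm2 + (m : ℂ) ^ 2 * ω ^ 2 * I_mul_I
  rw [kgOp_apply_near _ _ _ _ _ _ hm, hcoeff, smul_sub, smul_add, smul_smul]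

theorem kgOp_eq_zero_iff {ε ω θ σ : ℂ} (hε : ε ≠ 0) (hθ : ε * θ = 1 - ω ^ 2)
    (V : Modes d →L[ℂ] Modes d) (F : Modes d) :
    kgOp ε ω θ σ V F = 0 ↔ ∀ m : ℤ, (1 + (ε * σ + I * m * ω) ^ 2) • wt m • F m
      + ε • V (unweight F) m - ε • lap d (wt m • F m) = 0 := by
  have hmode : ∀ m : ℤ, kgOp ε ω θ σ V F m = 0 ↔ (1 + (ε * σ + I * m * ω) ^ 2) • wt m • F m
      + ε • V (unweight F) m - ε • lap d (wt m • F m) = 0 := fun m => by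
    by_cases hm : m = 1 ∨ m = -1
    · rw [← smul_kgOp_apply hθ V F hm, smul_eq_zero_iff_right hε]
    · rw [kgOp_apply_far _ _ _ _ _ _ hm]
  simp_rw [← hmode]
  exact ⟨fun h m => by rw [h]; rfl, fun h => lp.ext (funext h)⟩

end RescaledOperator

section BaseOperator

variable {d p : ℕ} {Ω : ℝ} {a : Latt d}

theorem fourierMul_two_smul_pairIn (a : Latt d) :
    fourierMul ((2 : ℂ) • pairIn (a, a))
      = (modeShift 1 + modeShift (-1)) * mapModes (siteMul a) := by
  ext F m n
  have hwt : ∀ k, wt k * ((2 : ℂ) • pairIn (a, a) : Modes d) k n = pairIn (a, a) k n := fun k =>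
    congrArg (fun G : Modes d => G k n) (unweight_two_smul_pairIn (a, a))
  rw [fourierMul_apply, tsum_eq_sum (s := {1, -1}) fun k hk => ?_, Finset.sum_pair (by norm_num),
    hwt, hwt, pairIn_one, pairIn_neg_one]
  · rfl
  · rw [hwt, pairIn_far _ (by simpa using hk)]
    exact zero_mul _

theorem fourierMul_pow_two_smul_pairIn (ha : ∀ n, (a n).im = 0) (p : ℕ) :
    fourierMul ((2 : ℂ) • pairIn (a, a)) ^ (2 * p)
      = (modeShift 1 + modeShift (-1)) ^ (2 * p) * mapModes (mulAbsPow a (2 * p)) := by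
  rw [fourierMul_two_smul_pairIn, Commute.mul_pow, ← mapModes_pow, siteMul_pow_eq_mulAbsPow ha]
  exact (modeShift_commute_mapModes _ _).add_left (modeShift_commute_mapModes _ _)

/-- The operator of the spectral problem at `ε = 0`, where `U(τ) = 2 a cos τ`. -/
def baseOp (p : ℕ) (Ω : ℝ) (a : Latt d) (σ : ℂ) : Modes d →L[ℂ] Modes d :=
  kgOp 0 1 Ω σ ((1 + 2 * p : ℂ) • fourierMul ((2 : ℂ) • pairIn (a, a)) ^ (2 * p))

theorem baseOp_apply_far (p : ℕ) (Ω : ℝ) (a : Latt d) (σ : ℂ) (F : Modes d) {m : ℤ}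
    (hm : ¬(m = 1 ∨ m = -1)) : baseOp p Ω a σ F m = ((1 - (m : ℂ) ^ 2) * wt m) • F m := by
  rw [baseOp, kgOp_apply_far _ _ _ _ _ _ hm, zero_smul, zero_smul, add_zero, sub_zero, smul_smul]
  congr 1
  linear_combination (m : ℂ) ^ 2 * wt m * I_mul_I

theorem baseOp_pairIn (hp : 1 ≤ p) (Ω : ℝ) (ha : ∀ n, (a n).im = 0) (σ : ℂ) (z : Latt d × Latt d) :
    baseOp p Ω a σ ((2 : ℂ) • pairIn z) = pairIn (pairOp p Ω a σ z) := by
  refine lp.ext (funext fun m => ?_)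
  by_cases hm : m = 1 ∨ m = -1
  · rw [baseOp, kgOp_apply_near _ _ _ _ _ _ hm, ← unweight_apply, unweight_two_smul_pairIn,
      fourierMul_pow_two_smul_pairIn ha, smul_apply, mul_apply_eq_comp, mapModes_pairIn,
      lp.coeFn_smul, Pi.smul_apply, pairOp, add_apply, pairDiag_apply, pairPot_apply, selfCoeff,
      crossCoeff]
    rcases hm with rfl | rfl
    · rw [modeShift_add_pow_pairIn_one, pairIn_one, pairIn_one, Prod.fst_add]
      push_cast
      module
    · rw [modeShift_add_pow_pairIn_neg_one hp, pairIn_neg_one, pairIn_neg_one, Prod.snd_add]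
      push_cast
      module
  · rw [baseOp_apply_far _ _ _ _ _ hm, lp.coeFn_smul, Pi.smul_apply, pairIn_far _ hm,
      pairIn_far _ hm, smul_zero, smul_zero]

theorem four_le_sq {m : ℤ} (hm : ¬(m = 1 ∨ m = -1)) (hm0 : m ≠ 0) : 4 ≤ m ^ 2 := by
  have h : m ≤ -2 ∨ 2 ≤ m := by omega
  rcases h with h | h <;> nlinarith

theorem one_sub_sq_ne_zero {m : ℤ} (hm : ¬(m = 1 ∨ m = -1)) : 1 - (m : ℂ) ^ 2 ≠ 0 := fun h =>
  hm (mul_self_eq_one_iff.mp (by rw [← pow_two]; exact_mod_cast (sub_eq_zero.mp h).symm))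

theorem norm_inv_one_sub_sq_mul_wt_le (m : ℤ) : ‖((1 - (m : ℂ) ^ 2) * wt m)⁻¹‖ ≤ 2 := by
  by_cases hm : m = 1 ∨ m = -1
  · have hm2 : (m : ℂ) ^ 2 = 1 := by
      rcases hm with rfl | rfl <;> norm_num
    norm_num [hm2]
  have e : (1 - (m : ℂ) ^ 2) = ((1 - (m : ℝ) ^ 2 : ℝ) : ℂ) := by push_cast; rfl
  rw [norm_inv, norm_mul, norm_wt, e, norm_real, Real.norm_eq_abs, mul_inv, inv_inv,
    inv_mul_eq_div]
  rcases eq_or_ne m 0 with rfl | hm0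
  · norm_num
  · have h4 : (4 : ℝ) ≤ (m : ℝ) ^ 2 := by exact_mod_cast four_le_sq hm hm0
    rw [abs_of_neg (by linarith), div_le_iff₀ (by linarith)]
    linarith

theorem isUnit_pairOp_add (hp : 1 ≤ p) (ha : ∀ n, (a n).im = 0) {σ : ℂ} (hσ : σ.re = 0)
    (h₁ : Ω - 2 * σ.im ∉ Set.Icc (-(4 * d : ℝ)) 0) (h₂ : Ω + 2 * σ.im ∉ Set.Icc (-(4 * d : ℝ)) 0)
    {K : (Latt d × Latt d) →L[ℂ] (Latt d × Latt d)} (hK : IsCompactOperator K)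
    (hinj : ∀ z, pairOp p Ω a σ z + K z = 0 → z = 0) : IsUnit (pairOp p Ω a σ + K) := by
  rw [pairOp, add_assoc]
  refine isUnit_add_of_isCompactOperator (isUnit_pairDiag hσ h₁ h₂)
    ((isCompactOperator_pairPot (isCompactOperator_mulAbsPow ha hp) _ _).add hK) fun z hz =>
      hinj z ?_
  rw [← hz, pairOp, add_apply, add_apply, add_assoc]

theorem bijective_baseOp_add (hp : 1 ≤ p) (ha : ∀ n, (a n).im = 0) {σ : ℂ} (hσ : σ.re = 0)
    (h₁ : Ω - 2 * σ.im ∉ Set.Icc (-(4 * d : ℝ)) 0) (h₂ : Ω + 2 * σ.im ∉ Set.Icc (-(4 * d : ℝ)) 0)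
    {K : (Latt d × Latt d) →L[ℂ] (Latt d × Latt d)} (hK : IsCompactOperator K)
    (hinj : ∀ z, pairOp p Ω a σ z + K z = 0 → z = 0) :
    Function.Bijective (baseOp p Ω a σ + pairIn.comp (K.comp pairOut)) := by
  refine bijective_of_pair_block (f := fun m => (1 - (m : ℂ) ^ 2) * wt m)
    (M := pairOp p Ω a σ + K) two_ne_zero (fun F m hm => ?_)
    (fun m hm => mul_ne_zero (one_sub_sq_ne_zero hm) (wt_ne_zero m)) norm_inv_one_sub_sq_mul_wt_le
    (fun z => ?_)
    (ContinuousLinearMap.isUnit_iff_bijective.mp (isUnit_pairOp_add hp ha hσ h₁ h₂ hK hinj))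
  · rw [add_apply, lp.coeFn_add, Pi.add_apply, baseOp_apply_far _ _ _ _ _ hm,
      ContinuousLinearMap.comp_apply, pairIn_far _ hm, add_zero]
  · rw [add_apply, baseOp_pairIn hp Ω ha, ContinuousLinearMap.comp_apply,
      ContinuousLinearMap.comp_apply, pairOut_two_smul_pairIn, ← map_add, ← add_apply]

end BaseOperator

section Symmetry

variable {d : ℕ}

/-- The reflection `m ↦ -m` of the Fourier index. -/
def reflect : Modes d →L[ℂ] Modes d := reindex (Equiv.neg ℤ)

@[simp]
theorem reflect_apply (F : Modes d) (m : ℤ) : reflect F m = F (-m) := rfl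

theorem star_wt (m : ℤ) : star (wt m) = wt m := by
  rw [wt_eq_ofReal]
  exact conj_ofReal _

theorem unweight_reflect (F : Modes d) : unweight (reflect F) = reflect (unweight F) :=
  lp.ext (funext fun m => by simp [wt_neg])

theorem unweight_star (F : Modes d) : unweight (star F) = star (unweight F) := by
  refine lp.ext (funext fun m => ?_)
  rw [lp.star_apply, unweight_apply, unweight_apply, lp.star_apply, star_smul, star_wt]

theorem fourierMul_reflect (F G : Modes d) :
    fourierMul (reflect F) (reflect G) = reflect (fourierMul F G) := by
  refine lp.ext (funext fun m => lp.ext (funext fun n => ?_))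
  rw [reflect_apply, fourierMul_apply, fourierMul_apply, ← (Equiv.neg ℤ).tsum_eq]
  refine tsum_congr fun k => ?_
  rw [Equiv.neg_apply, wt_neg, reflect_apply, reflect_apply, neg_neg, sub_neg_eq_add, neg_add',
    sub_eq_add_neg (-m) k]

theorem fourierMul_star (F G : Modes d) :
    fourierMul (star F) (star G) = star (fourierMul F G) := by
  refine lp.ext (funext fun m => lp.ext (funext fun n => ?_))
  rw [lp.star_apply, lp.star_apply, fourierMul_apply, fourierMul_apply, tsum_star]
  refine tsum_congr fun k => ?_
  simp only [lp.star_apply, star_mul', star_wt]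

theorem fourierMul_pow_reflect (F G : Modes d) (j : ℕ) :
    (fourierMul (reflect F) ^ j) (reflect G) = reflect ((fourierMul F ^ j) G) := by
  induction j with
  | zero => rfl
  | succ j ih => rw [fourierMul_pow_succ_apply, fourierMul_pow_succ_apply, ih, fourierMul_reflect]

theorem fourierMul_pow_star (F G : Modes d) (j : ℕ) :
    (fourierMul (star F) ^ j) (star G) = star ((fourierMul F ^ j) G) := by
  induction j with
  | zero => rfl
  | succ j ih => rw [fourierMul_pow_succ_apply, fourierMul_pow_succ_apply, ih, fourierMul_star]

theorem shift_star (v : Fin d → ℤ) (u : Latt d) : shift v (star u) = star (shift v u) := rfl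

theorem lap_star (u : Latt d) : lap d (star u) = star (lap d u) := by
  simp only [lap, sum_apply, sub_apply, add_apply, smul_apply, shift_star, star_sum, star_sub,
    star_add, star_smul, ContinuousLinearMap.id_apply, star_ofNat]

theorem mulAbsPow_star (a u : Latt d) (k : ℕ) :
    mulAbsPow a k (star u) = star (mulAbsPow a k u) := by
  refine lp.ext (funext fun n => ?_)
  change (‖a n‖ : ℂ) ^ k * star (u n) = star ((‖a n‖ : ℂ) ^ k * u n)
  simp

theorem kgOp_apply_zero (ε ω θ : ℂ) (V : Modes d →L[ℂ] Modes d) (F : Modes d) (m : ℤ) :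
    kgOp ε ω θ 0 V F m
      = (if m = 1 ∨ m = -1 then θ else 1 - (m : ℂ) ^ 2 * ω ^ 2) • wt m • F m
        + (if m = 1 ∨ m = -1 then 1 else ε) • (V (unweight F) m - lap d (wt m • F m)) := by
  split_ifs with hm
  · rw [kgOp_apply_near _ _ _ _ _ _ hm]
    module
  · rw [kgOp_apply_far _ _ _ _ _ _ hm]
    linear_combination (norm := module) ((m : ℂ) ^ 2 * ω ^ 2 * I_mul_I) • wt m • F m

theorem kgOp_reflect (ε ω θ : ℂ) (F G : Modes d) (j : ℕ) :
    kgOp ε ω θ 0 (fourierMul (reflect F) ^ j) (reflect G)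
      = reflect (kgOp ε ω θ 0 (fourierMul F ^ j) G) := by
  refine lp.ext (funext fun m => ?_)
  have hm : (-m = 1 ∨ -m = -1) ↔ (m = 1 ∨ m = -1) := by omega
  rw [reflect_apply, kgOp_apply_zero, kgOp_apply_zero, unweight_reflect, fourierMul_pow_reflect,
    reflect_apply, reflect_apply, wt_neg]
  simp only [hm, Int.cast_neg, neg_sq]

theorem kgOp_star (ε ω θ : ℝ) (F G : Modes d) (j : ℕ) :
    kgOp ε ω θ 0 (fourierMul (star F) ^ j) (star G)
      = star (kgOp ε ω θ 0 (fourierMul F ^ j) G) := by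
  refine lp.ext (funext fun m => ?_)
  rw [lp.star_apply, kgOp_apply_zero, kgOp_apply_zero, unweight_star, fourierMul_pow_star,
    lp.star_apply, lp.star_apply, star_add, star_smul, star_smul, star_smul, star_sub, ← lap_star,
    star_smul, star_wt]
  split_ifs <;> simp

theorem reflect_pairIn (z : Latt d × Latt d) : reflect (pairIn z) = pairIn z.swap := by
  refine lp.ext (funext fun m => ?_)
  have hone : -m = 1 ↔ m = -1 := by omega
  have hneg : -m = -1 ↔ m = 1 := by omega
  rw [reflect_apply, pairIn_apply, pairIn_apply, add_comm]
  simp only [hone, hneg, Prod.fst_swap, Prod.snd_swap]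

theorem star_pairIn (z : Latt d × Latt d) : star (pairIn z) = pairIn (star z) := by
  refine lp.ext (funext fun m => ?_)
  rw [lp.star_apply, pairIn_apply, pairIn_apply, star_add]
  congr 1
  · split_ifs <;> simp
  · split_ifs <;> simp

theorem pairOut_reflect (F : Modes d) : pairOut (reflect F) = (pairOut F).swap := by
  rw [pairOut_apply, pairOut_apply, reflect_apply, reflect_apply, neg_neg, wt_neg, Prod.swap]

theorem pairOut_star (F : Modes d) : pairOut (star F) = star (pairOut F) := by
  rw [pairOut_apply, pairOut_apply, lp.star_apply, lp.star_apply]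
  refine Prod.ext ?_ ?_
  · rw [Prod.fst_star, star_smul, star_wt]
  · rw [Prod.snd_star, star_smul, star_wt]

theorem oddCorrection_apply (p : ℕ) (a : Latt d) (z : Latt d × Latt d) :
    oddCorrection p a z = (((gam p : ℂ) / 2) • mulAbsPow a (2 * p) (z.2 - z.1),
      ((gam p : ℂ) / 2) • mulAbsPow a (2 * p) (z.1 - z.2)) := by
  rw [oddCorrection, pairPot_apply, map_sub, map_sub]
  refine Prod.ext ?_ ?_
  · dsimp only
    module
  · dsimp only
    module

theorem oddCorrection_swap (p : ℕ) (a : Latt d) (z : Latt d × Latt d) :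
    oddCorrection p a z.swap = (oddCorrection p a z).swap := by
  rw [oddCorrection_apply, oddCorrection_apply]
  rfl

theorem oddCorrection_star (p : ℕ) (a : Latt d) (z : Latt d × Latt d) :
    oddCorrection p a (star z) = star (oddCorrection p a z) := by
  have hgam : star ((gam p : ℂ) / 2) = (gam p : ℂ) / 2 := by simp
  rw [oddCorrection_apply, oddCorrection_apply]
  refine Prod.ext ?_ ?_
  · simp only [Prod.fst_star, Prod.snd_star, star_smul, hgam, ← mulAbsPow_star, star_sub]
  · simp only [Prod.fst_star, Prod.snd_star, star_smul, hgam, ← mulAbsPow_star, star_sub]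

theorem oddCorrection_eq_zero (p : ℕ) (a : Latt d) {z : Latt d × Latt d} (hz : z.swap = z) :
    oddCorrection p a z = 0 := by
  have h : z.2 = z.1 := congrArg Prod.fst hz
  rw [oddCorrection_apply, h, sub_self, map_zero, smul_zero, Prod.mk_zero_zero]

theorem IsSoliton.star_eq {p : ℕ} {Ω : ℝ} {a : Latt d} (ha : IsSoliton p Ω a) : star a = a :=
  lp.ext (funext fun n => conj_eq_iff_im.mpr (ha.1 n))

end Symmetry

section BreatherMap

variable {d p : ℕ} {Ω : ℝ} {a : Latt d}

/-- The map whose zeros near `((0, 1), 2 cos τ • a)` with real coefficients that are even in `m`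
are the breathers. The last term vanishes on even sequences; without it, the derivative at the
soliton would have a kernel, namely the odd sequence `m ↦ m a` for `m = ±1`. -/
def breatherMap (p : ℕ) (Ω : ℝ) (a : Latt d) (v : (ℂ × ℂ) × Modes d) : Modes d :=
  kgOp v.1.1 v.1.2 Ω 0 (fourierMul v.2 ^ (2 * p)) v.2
    + pairIn (oddCorrection p a (pairOut v.2))

theorem analyticAt_breatherMap (p : ℕ) (Ω : ℝ) (a : Latt d) (v : (ℂ × ℂ) × Modes d) :
    AnalyticAt ℂ (breatherMap p Ω a) v := by
  have hsnd : AnalyticAt ℂ (fun w : (ℂ × ℂ) × Modes d => w.2) v := analyticAt_snd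
  have hV : AnalyticAt ℂ (fun w : (ℂ × ℂ) × Modes d => fourierMul w.2 ^ (2 * p)) v :=
    ((ContinuousLinearMap.analyticAt fourierMul _).comp hsnd).pow _
  have hkg := analyticAt_kgOp (ε := fun w : (ℂ × ℂ) × Modes d => w.1.1) (ω := fun w => w.1.2)
    (θ := fun _ => (Ω : ℂ)) (σ := fun _ => 0) (analyticAt_fst.comp analyticAt_fst)
    (analyticAt_snd.comp analyticAt_fst) analyticAt_const analyticAt_const hV
  have hodd : AnalyticAt ℂ
      (fun w : (ℂ × ℂ) × Modes d => pairIn (oddCorrection p a (pairOut w.2))) v :=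
    ((pairIn.comp ((oddCorrection p a).comp pairOut)).analyticAt _).comp hsnd
  exact (analyticAt_clm_apply hkg hsnd).add hodd

theorem kgOp_zero_eq (Ω : ℝ) (V : Modes d →L[ℂ] Modes d) :
    kgOp 0 1 Ω 0 V = kgOp 0 1 Ω 0 0 + near * (V * unweight) := by
  simp only [kgOp, zero_smul, zero_sub, sub_mul, neg_mul, add_zero, mul_add, mul_sub, mul_neg]
  abel

theorem hasFDerivAt_breatherMap (p : ℕ) (Ω : ℝ) (a : Latt d) :
    HasFDerivAt (fun F => breatherMap p Ω a ((0, 1), F))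
      (baseOp p Ω a 0 + pairIn.comp ((oddCorrection p a).comp pairOut))
      ((2 : ℂ) • pairIn (a, a)) := by
  have hpow := (near (d := d)).hasFDerivAt.comp _
    (hasFDerivAt_fourierMul_pow_unweight ((2 : ℂ) • pairIn (a, a)) (2 * p))
  have hsum := (((kgOp 0 1 Ω 0 0 : Modes d →L[ℂ] Modes d).hasFDerivAt.add hpow).add
    (pairIn.comp ((oddCorrection p a).comp pairOut)).hasFDerivAt)
  refine (hsum.congr_fderiv ?_).congr_of_eventuallyEq (Eventually.of_forall fun F => ?_)
  · congr 1
    rw [baseOp, kgOp_zero_eq Ω (_ • _), smul_mul_assoc]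
    congr 1
    push_cast
    rw [add_comm (2 * (p : ℂ)) 1]
    rfl
  · change kgOp 0 1 Ω 0 (fourierMul F ^ (2 * p)) F + _ = _
    rw [kgOp_zero_eq]
    rfl

theorem choose_add_choose_succ_eq_gam (p : ℕ) :
    ((2 * p).choose p : ℂ) + ((2 * p).choose (p + 1) : ℂ) = gam p := by
  rw [gam, add_comm 1 (2 * p), add_comm 1 p, Nat.choose_succ_succ]
  push_cast
  ring

theorem breatherMap_base (hp : 1 ≤ p) (ha : IsSoliton p Ω a) :
    breatherMap p Ω a ((0, 1), (2 : ℂ) • pairIn (a, a)) = 0 := by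
  have hsol : (Ω : ℂ) • a + (((2 * p).choose p : ℂ) • mulAbsPow a (2 * p) a
      + ((2 * p).choose (p + 1) : ℂ) • mulAbsPow a (2 * p) a) - lap d a = 0 := by
    rw [← add_smul, choose_add_choose_succ_eq_gam, ha.2, sub_self]
  rw [breatherMap, pairOut_two_smul_pairIn, oddCorrection_eq_zero p a rfl, map_zero, add_zero]
  refine lp.ext (funext fun m => ?_)
  rw [kgOp_apply_zero, ← unweight_apply, unweight_two_smul_pairIn,
    fourierMul_pow_two_smul_pairIn ha.1, mul_apply_eq_comp, mapModes_pairIn]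
  by_cases hm : m = 1 ∨ m = -1
  · rw [if_pos hm, if_pos hm, one_smul, ← add_sub_assoc]
    rcases hm with rfl | rfl
    · rw [modeShift_add_pow_pairIn_one, pairIn_one]
      exact hsol
    · rw [modeShift_add_pow_pairIn_neg_one hp, pairIn_neg_one]
      exact hsol
  · rw [if_neg hm, if_neg hm, zero_smul, add_zero, pairIn_far _ hm, smul_zero]
    rfl

theorem breatherMap_reflect (p : ℕ) (Ω : ℝ) (a : Latt d) (q : ℂ × ℂ) (F : Modes d) :
    breatherMap p Ω a (q, reflect F) = reflect (breatherMap p Ω a (q, F)) := by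
  rw [breatherMap, breatherMap, kgOp_reflect, map_add, reflect_pairIn, pairOut_reflect,
    oddCorrection_swap]

theorem breatherMap_star (p : ℕ) (Ω : ℝ) (a : Latt d) (ε ω : ℝ) (F : Modes d) :
    breatherMap p Ω a (((ε : ℂ), (ω : ℂ)), star F)
      = star (breatherMap p Ω a (((ε : ℂ), (ω : ℂ)), F)) := by
  rw [breatherMap, breatherMap, star_add, star_pairIn, ← oddCorrection_star, ← pairOut_star]
  dsimp only
  rw [kgOp_star]

end BreatherMap

section BreatherBranch

variable {d p : ℕ} {Ω : ℝ} {a : Latt d}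

theorem weighted_wt_smul (F : Modes d) (m : ℤ) : weighted (fun m => wt m • F m) m = F m := by
  rw [weighted, smul_smul, wt, mul_inv_cancel₀ (one_add_sq_ne_zero m), one_smul]

theorem memL22_wt_smul (F : Modes d) : MemL22 fun m => wt m • F m := by
  rw [MemL22, funext (weighted_wt_smul F)]
  exact lp.memℓp F

theorem im_wt_smul_apply_eq_zero {F : Modes d} (hreal : star F = F) (m : ℤ) (n : Fin d → ℤ) :
    ((wt m • F m) n).im = 0 := by
  have hF : star (F m n) = F m n := congrArg (fun G : Modes d => G m n) hreal
  refine conj_eq_iff_im.mp ?_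
  change star (wt m * F m n) = wt m * F m n
  rw [star_mul', star_wt, hF]

theorem isBreather_of_kgOp_eq_zero {ε ω θ : ℝ} (hε : ε ≠ 0) (hθ : ε * θ = 1 - ω ^ 2) {F : Modes d}
    (hF : kgOp ε ω θ 0 (fourierMul F ^ (2 * p)) F = 0) (heven : reflect F = F)
    (hreal : star F = F) : IsBreather p ε ω fun m => wt m • F m where
  mem := memL22_wt_smul F
  real := im_wt_smul_apply_eq_zero hreal
  even m := by
    rw [wt_neg, ← reflect_apply, heven]
  eqn m n := by
    have hmode : (1 + (ε * 0 + I * m * ω) ^ 2 : ℂ) * (wt m • F m) n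
        + ε * (fourierMul F ^ (2 * p)) (unweight F) m n - ε * lap d (wt m • F m) n = 0 :=
      congrArg (fun u : Latt d => u n)
        ((kgOp_eq_zero_iff (by exact_mod_cast hε) (by exact_mod_cast hθ) _ _).mp hF m)
    have hpi : (Real.pi : ℂ) ≠ 0 := by exact_mod_cast Real.pi_ne_zero
    have hcoeff : (ε : ℂ) / (2 * Real.pi)
        * (2 * Real.pi * (fourierMul F ^ (2 * p)) (unweight F) m n)
        = ε * (fourierMul F ^ (2 * p)) (unweight F) m n := by
      field_simp
    simp_rw [add_comm 1 (2 * p), pow_succ]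
    rw [integral_fourierSum_pow_mul, hcoeff]
    linear_combination hmode - (m : ℂ) ^ 2 * ω ^ 2 * (wt m • F m) n * I_mul_I

theorem isBreather_of_breatherMap_eq_zero {ε ω : ℝ} (hε : ε ≠ 0) (hω : ε * Ω = 1 - ω ^ 2)
    {F : Modes d} (hF : breatherMap p Ω a ((ε, ω), F) = 0) (heven : reflect F = F)
    (hreal : star F = F) : IsBreather p ε ω fun m => wt m • F m := by
  have hodd : oddCorrection p a (pairOut F) = 0 :=
    oddCorrection_eq_zero p a (by rw [← pairOut_reflect, heven])
  rw [breatherMap, hodd, map_zero, add_zero] at hF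
  exact isBreather_of_kgOp_eq_zero hε hω hF heven hreal

/-- The frequency of the breather, normalised by `1 - ω² = ε Ω`. -/
def breatherFreq (Ω ε : ℝ) : ℝ := √(1 - ε * Ω)

theorem breatherFreq_zero (Ω : ℝ) : breatherFreq Ω 0 = 1 := by
  rw [breatherFreq, zero_mul, sub_zero, Real.sqrt_one]

theorem breatherFreq_sq {ε : ℝ} (h : 0 ≤ 1 - ε * Ω) : breatherFreq Ω ε ^ 2 = 1 - ε * Ω :=
  Real.sq_sqrt h

theorem analyticAt_breatherFreq_zero (Ω : ℝ) : AnalyticAt ℝ (breatherFreq Ω) 0 := by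
  have hsqrt : AnalyticAt ℝ Real.sqrt (1 - 0 * Ω) :=
    (Real.contDiffAt_sqrt (by norm_num)).analyticAt
  exact hsqrt.comp (f := fun ε : ℝ => 1 - ε * Ω) (by fun_prop)

theorem abs_breatherFreq_sub_le {ε : ℝ} (h : 0 ≤ 1 - ε * Ω) :
    |breatherFreq Ω ε - 1 + ε * Ω / 2| ≤ Ω ^ 2 / 2 * ε ^ 2 := by
  have hsq := breatherFreq_sq h
  set ω := breatherFreq Ω ε
  have hω : 0 ≤ ω := Real.sqrt_nonneg _
  have hrem : ω - 1 + ε * Ω / 2 = -((ω - 1) ^ 2 / 2) := by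
    linear_combination (1 / 2 : ℝ) * hsq
  have hprod : (ω - 1) ^ 2 * (ω + 1) ^ 2 = Ω ^ 2 * ε ^ 2 := by
    rw [← mul_pow, ← mul_pow, ← neg_sq (Ω * ε)]
    congr 1
    linear_combination hsq
  have hle : (ω - 1) ^ 2 ≤ (ω - 1) ^ 2 * (ω + 1) ^ 2 :=
    le_mul_of_one_le_right (sq_nonneg _) (by nlinarith)
  rw [hrem, abs_neg, abs_of_nonneg (by positivity)]
  linarith

theorem tsum_norm_wt_shift_le (F : Modes d) :
    ∑' m : ℕ, ‖wt (m + 2) • F (m + 2)‖ ≤ wtSum * ‖F‖ :=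
  (tsum_comp_le_tsum_of_inj (summable_norm_wt_smul F) (fun _ => norm_nonneg _)
    (i := fun m : ℕ => (m : ℤ) + 2) fun _ _ h => by simpa using h).trans (tsum_norm_wt_smul_le F)

theorem norm_wt_smul_sub_le (F : Modes d) (a : Latt d) :
    ‖wt 0 • F 0‖ + ‖wt 1 • F 1 - a‖ + ∑' m : ℕ, ‖wt (m + 2) • F (m + 2)‖
      ≤ (2 + wtSum) * ‖F - (2 : ℂ) • pairIn (a, a)‖ := by
  set G : Modes d := F - (2 : ℂ) • pairIn (a, a)
  have hGapply : ∀ m : ℤ, G m = F m - (2 : ℂ) • pairIn (a, a) m := fun m => rfl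
  have hfar : ∀ m : ℤ, ¬(m = 1 ∨ m = -1) → F m = G m := fun m hm => by
    rw [hGapply, pairIn_far _ hm, smul_zero, sub_zero]
  have hone : wt 1 • F 1 - a = wt 1 • G 1 := by
    rw [hGapply, pairIn_one, wt_one]
    module
  have htail : ∀ m : ℕ, F (m + 2) = G (m + 2) := fun m => hfar _ (by omega)
  rw [hone, hfar 0 (by norm_num)]
  simp_rw [htail]
  linarith [tsum_norm_wt_shift_le G, norm_wt_smul_le G 0, norm_wt_smul_le G 1]

theorem eventually_apply_implicit_eq_zero {P X Y T : Type*} [TopologicalSpace P]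
    [TopologicalSpace X] [Zero Y] {f : P × X → Y} {φ : P → X} {p₀ : P} {q : T → P} {l : Filter T}
    (hφ : ContinuousAt φ p₀) (hf : ∀ᶠ v in 𝓝 (p₀, φ p₀), f v = 0 ↔ φ v.1 = v.2)
    (hq : Tendsto q l (𝓝 p₀)) : ∀ᶠ t in l, f (q t, φ (q t)) = 0 :=
  ((hq.prodMk_nhds (hφ.tendsto.comp hq)).eventually hf).mono fun _ ht => ht.mpr rfl

theorem eventually_map_implicit_eq {P X Y T : Type*} [TopologicalSpace P] [TopologicalSpace X]
    [Zero Y] {f : P × X → Y} {φ : P → X} {p₀ : P} {q : T → P} {l : Filter T} {s : X → X}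
    (hφ : ContinuousAt φ p₀) (hf : ∀ᶠ v in 𝓝 (p₀, φ p₀), f v = 0 ↔ φ v.1 = v.2)
    (hq : Tendsto q l (𝓝 p₀)) (hs : ContinuousAt s (φ p₀)) (hs₀ : s (φ p₀) = φ p₀)
    (hsf : ∀ t x, f (q t, x) = 0 → f (q t, s x) = 0) : ∀ᶠ t in l, s (φ (q t)) = φ (q t) := by
  have hsφ : Tendsto (fun t => s (φ (q t))) l (𝓝 (φ p₀)) := by
    have h := hs.tendsto.comp (hφ.tendsto.comp hq)
    rwa [hs₀] at h
  filter_upwards [eventually_apply_implicit_eq_zero hφ hf hq,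
    (hq.prodMk_nhds hsφ).eventually hf] with t hzero huniq
  exact (huniq.mp (hsf t _ hzero)).symm

theorem exists_analytic_symmetric_zero (hp : 1 ≤ p) (hΩ : Ω ∉ Set.Icc (-(4 * d : ℝ)) 0)
    (ha : IsSoliton p Ω a) (hJ : ∀ v : Latt d, jac p Ω a v = 0 → v = 0) :
    ∃ Φ : ℝ → Modes d, AnalyticAt ℝ Φ 0 ∧ Φ 0 = (2 : ℂ) • pairIn (a, a) ∧
      ∀ᶠ ε : ℝ in 𝓝 0, breatherMap p Ω a ((ε, breatherFreq Ω ε), Φ ε) = 0 ∧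
        reflect (Φ ε) = Φ ε ∧ star (Φ ε) = Φ ε := by
  obtain ⟨φ, hφ, hφ₀, hiff⟩ := exists_analytic_implicit (analyticAt_breatherMap p Ω a _)
    (breatherMap_base hp ha) (hasFDerivAt_breatherMap p Ω a)
    (bijective_baseOp_add hp ha.1 (σ := 0) rfl (by simpa using hΩ) (by simpa using hΩ)
      (isCompactOperator_pairPot (isCompactOperator_mulAbsPow ha.1 hp) _ _)
      (pairOp_add_oddCorrection_injective hΩ hJ))
  let q : ℝ → ℂ × ℂ := fun ε => (ε, breatherFreq Ω ε)
  have hq₀ : q 0 = (0, 1) := by simp [q, breatherFreq_zero]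
  have hq : AnalyticAt ℝ q 0 := (ofRealCLM.analyticAt 0).prod
    ((ofRealCLM.analyticAt _).comp (analyticAt_breatherFreq_zero Ω))
  rw [← hq₀] at hφ hφ₀ hiff
  rw [← hφ₀] at hiff
  have hreflect : reflect (φ (q 0)) = φ (q 0) := by
    rw [hφ₀, map_smul, reflect_pairIn, Prod.swap_prod_mk]
  have hstar : star (φ (q 0)) = φ (q 0) := by
    have haa : star (a, a) = (a, a) := Prod.ext ha.star_eq ha.star_eq
    rw [hφ₀, star_smul, star_pairIn, haa, star_ofNat]
  have hqt := hq.continuousAt.tendsto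
  have hφc := hφ.continuousAt
  refine ⟨fun ε => φ (q ε), AnalyticAt.comp (g := φ) hφ.restrictScalars hq, hφ₀, ?_⟩
  exact (eventually_apply_implicit_eq_zero (φ := φ) (q := q) hφc hiff hqt).and
    ((eventually_map_implicit_eq (φ := φ) (q := q) hφc hiff hqt reflect.continuous.continuousAt
        hreflect fun ε F hF => by rw [breatherMap_reflect, hF, map_zero]).and
      (eventually_map_implicit_eq (φ := φ) (q := q) hφc hiff hqt continuous_star.continuousAt hstar
        fun ε F hF => by rw [breatherMap_star, hF, star_zero]))

theorem exists_breatherBranch (hp : 1 ≤ p) (hΩ : Ω ∉ Set.Icc (-(4 * d : ℝ)) 0)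
    (ha : IsSoliton p Ω a) (hJ : ∀ v : Latt d, jac p Ω a v = 0 → v = 0) :
    ∃ (ε₁ C₁ : ℝ) (ω : ℝ → ℝ) (A : ℝ → ℤ → Latt d), IsBreatherBranch p Ω a ε₁ C₁ ω A := by
  obtain ⟨Φ, hΦ, hΦ₀, hzero⟩ := exists_analytic_symmetric_zero hp hΩ ha hJ
  obtain ⟨C, hC⟩ := hΦ.differentiableAt.isBigO_sub.bound
  have hpos : ∀ᶠ ε : ℝ in 𝓝 0, 0 < 1 - ε * Ω :=
    Tendsto.eventually_const_lt (v := 1 - 0 * Ω) (by norm_num)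
      (ContinuousAt.tendsto (by fun_prop))
  obtain ⟨ε₁, hε₁, hball⟩ := Metric.eventually_nhds_iff.mp
    ((hC.and hpos).and ((hΦ.eventually_analyticAt.and
      (analyticAt_breatherFreq_zero Ω).eventually_analyticAt).and hzero))
  have hIoo : ∀ ε ∈ Set.Ioo 0 ε₁, dist ε 0 < ε₁ := fun ε hε => by
    rw [Real.dist_eq, sub_zero, abs_of_pos hε.1]
    exact hε.2
  refine ⟨ε₁, max ((2 + wtSum) * C) (Ω ^ 2 / 2), breatherFreq Ω, fun ε m => wt m • Φ ε m, hε₁,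
    fun ε hε => (hball (hIoo ε hε)).2.1.2,
    ⟨Φ, fun ε hε => (hball (hIoo ε hε)).2.1.1, fun ε _ m => (weighted_wt_smul (Φ ε) m).symm⟩,
    fun ε hε => ?_, fun ε hε => ?_, fun ε hε => ?_⟩
  · obtain ⟨⟨-, hfreq⟩, -, hmap, heven, hreal⟩ := hball (hIoo ε hε)
    refine isBreather_of_breatherMap_eq_zero hε.1.ne' ?_ hmap heven hreal
    rw [breatherFreq_sq hfreq.le, sub_sub_cancel]
  · refine (abs_breatherFreq_sub_le (hball (hIoo ε hε)).1.2.le).trans ?_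
    gcongr
    exact le_max_right _ _
  · have hbound := (hball (hIoo ε hε)).1.1
    rw [hΦ₀, sub_zero, Real.norm_of_nonneg hε.1.le] at hbound
    calc ‖wt 0 • Φ ε 0‖ + ‖wt 1 • Φ ε 1 - a‖ + ∑' m : ℕ, ‖wt (m + 2) • Φ ε (m + 2)‖
        ≤ (2 + wtSum) * ‖Φ ε - (2 : ℂ) • pairIn (a, a)‖ := norm_wt_smul_sub_le (Φ ε) a
      _ ≤ (2 + wtSum) * (C * ε) :=
          mul_le_mul_of_nonneg_left hbound (by linarith [wtSum_nonneg])
      _ = (2 + wtSum) * C * ε := (mul_assoc _ _ _).symm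
      _ ≤ max ((2 + wtSum) * C) (Ω ^ 2 / 2) * ε :=
          mul_le_mul_of_nonneg_right (le_max_left _ _) hε.1.le

end BreatherBranch

section SpectralProblem

variable {d p : ℕ} {Ω : ℝ} {a : Latt d} {Λ : ℂ}

/-- The space of the parameters `(ε, ω, (1 - ω²) / ε, M)` of the spectral problem, where `M` is the
operator of multiplication by the breather. -/
abbrev Params (d : ℕ) : Type := ℂ × ℂ × ℂ × (Modes d →L[ℂ] Modes d)

/-- The operator of the spectral problem at the parameters `v.1` and the eigenvalue `ε * v.2`. -/
def spectralOp (p : ℕ) (v : Params d × ℂ) : Modes d →L[ℂ] Modes d :=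
  kgOp v.1.1 v.1.2.1 v.1.2.2.1 v.2 ((1 + 2 * p : ℂ) • v.1.2.2.2 ^ (2 * p))

/-- The parameters in the limit `ε → 0`. -/
def baseParams (Ω : ℝ) (a : Latt d) : Params d :=
  (0, 1, (Ω : ℂ), fourierMul ((2 : ℂ) • pairIn (a, a)))

/-- The parameters at a breather with frequency `ω` and weighted Fourier coefficients `Φ`. -/
def branchParams (ε ω : ℝ) (Φ : Modes d) : Params d :=
  ((ε : ℂ), (ω : ℂ), (((1 - ω ^ 2) / ε : ℝ) : ℂ), fourierMul Φ)

theorem analyticAt_spectralOp (p : ℕ) (v : Params d × ℂ) : AnalyticAt ℂ (spectralOp p) v := by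
  have hq : AnalyticAt ℂ (fun w : Params d × ℂ => w.1) v := analyticAt_fst
  have hω : AnalyticAt ℂ (fun w : Params d × ℂ => w.1.2) v := analyticAt_snd.comp hq
  have hθ : AnalyticAt ℂ (fun w : Params d × ℂ => w.1.2.2) v := analyticAt_snd.comp hω
  have hM : AnalyticAt ℂ (fun w : Params d × ℂ => w.1.2.2.2) v := analyticAt_snd.comp hθ
  have hV : AnalyticAt ℂ (fun w : Params d × ℂ => (1 + 2 * p : ℂ) • w.1.2.2.2 ^ (2 * p)) v :=
    analyticAt_const.fun_smul (hM.fun_pow (2 * p))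
  exact analyticAt_kgOp (analyticAt_fst.comp hq) (analyticAt_fst.comp hω) (analyticAt_fst.comp hθ)
    analyticAt_snd hV

theorem spectralOp_base (p : ℕ) (Ω : ℝ) (a : Latt d) (σ : ℂ) :
    spectralOp p (baseParams Ω a, σ) = baseOp p Ω a σ := rfl

theorem spectralOp_branchParams_eq_zero_iff {ε ω : ℝ} (hε : ε ≠ 0) {Φ F : Modes d} {σ : ℂ} :
    spectralOp p (branchParams ε ω Φ, σ) F = 0 ↔
      ∀ m : ℤ, (1 + (ε * σ + I * m * ω) ^ 2) • wt m • F m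
        + (ε * (1 + 2 * p) : ℂ) • (fourierMul Φ ^ (2 * p)) (unweight F) m
        - (ε : ℂ) • lap d (wt m • F m) = 0 := by
  have hθ : (ε : ℂ) * (((1 - ω ^ 2) / ε : ℝ) : ℂ) = 1 - (ω : ℂ) ^ 2 := by
    rw [← ofReal_mul, mul_div_cancel₀ _ hε, ofReal_sub, ofReal_one, ofReal_pow]
  rw [spectralOp, branchParams, kgOp_eq_zero_iff (ofReal_ne_zero.mpr hε) hθ]
  simp_rw [smul_apply, lp.coeFn_smul, Pi.smul_apply, smul_smul]

theorem isEigenpair_iff {ε ω : ℝ} (hε : ε ≠ 0) {Φ F : Modes d} {σ : ℂ} :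
    IsEigenpair p ε ω (fun m => wt m • Φ m) (ε * σ) (fun m => wt m • F m)
      ↔ F ≠ 0 ∧ spectralOp p (branchParams ε ω Φ, σ) F = 0 := by
  have hne : (fun m => wt m • F m) ≠ 0 ↔ F ≠ 0 := by
    refine not_congr ⟨fun h => lp.ext (funext fun m => ?_), fun h => ?_⟩
    · exact (smul_eq_zero_iff_right (wt_ne_zero m)).mp (congrFun h m)
    · rw [h]
      exact funext fun m => smul_zero _
  have heqn : (∀ (m : ℤ) (n : Fin d → ℤ), (1 + (ε * σ + I * m * ω) ^ 2) * (wt m • F m) n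
      + (ε : ℂ) * (1 + 2 * p) / (2 * Real.pi) *
        ∫ τ in (-Real.pi)..Real.pi, fourierSum (fun m => wt m • Φ m) n τ ^ (2 * p)
          * fourierSum (fun m => wt m • F m) n τ * exp (-(I * m * τ))
      = ε * lap d (wt m • F m) n) ↔ spectralOp p (branchParams ε ω Φ, σ) F = 0 := by
    rw [spectralOp_branchParams_eq_zero_iff hε]
    refine forall_congr' fun m => ?_
    rw [lp.ext_iff, funext_iff]
    refine forall_congr' fun n => ?_
    have hpi : (Real.pi : ℂ) ≠ 0 := ofReal_ne_zero.mpr Real.pi_ne_zero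
    rw [integral_fourierSum_pow_mul, ← sub_eq_zero, ← mul_assoc,
      div_mul_cancel₀ _ (mul_ne_zero two_ne_zero hpi)]
    rfl
  exact ⟨fun h => ⟨hne.mp h.ne_zero, heqn.mp h.eqn⟩,
    fun h => ⟨memL22_wt_smul F, hne.mpr h.1, heqn.mpr h.2⟩⟩

theorem spectralOp_star {ε ω : ℝ} (hε : ε ≠ 0) {Φ F : Modes d} (hΦ : star Φ = Φ) {σ : ℂ}
    (h : spectralOp p (branchParams ε ω Φ, σ) F = 0) :
    spectralOp p (branchParams ε ω Φ, -star σ) (star F) = 0 := by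
  rw [spectralOp_branchParams_eq_zero_iff hε] at h ⊢
  intro m
  have hsymb : star (1 + (ε * σ + I * m * ω) ^ 2) = 1 + (ε * -star σ + I * m * ω) ^ 2 := by
    simp only [star_add, star_one, star_pow, star_mul', star_intCast, star_def, conj_ofReal, conj_I]
    ring
  have hcoeff : star (ε * (1 + 2 * p) : ℂ) = ε * (1 + 2 * p) := by simp
  have hstar := congrArg star (h m)
  rw [star_sub, star_add, star_smul, star_smul, star_smul, star_smul, ← lap_star, star_smul, hsymb,
    hcoeff, star_wt, star_zero, ← lp.star_apply, ← lp.star_apply, ← fourierMul_pow_star,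
    ← unweight_star, hΦ, star_def, conj_ofReal] at hstar
  exact hstar

theorem not_mem_Icc_of_not_mem_contSpec (hre : Λ.re = 0) (hΛ : 2 * Λ ∉ contSpec d Ω) :
    Ω - 2 * Λ.im ∉ Set.Icc (-(4 * d : ℝ)) 0 ∧ Ω + 2 * Λ.im ∉ Set.Icc (-(4 * d : ℝ)) 0 := by
  have hΛI : 2 * Λ = I * ((2 * Λ.im : ℝ) : ℂ) := by
    apply Complex.ext <;> simp [hre]
  refine ⟨fun h => hΛ ⟨2 * Λ.im, ⟨by linarith [h.2], by linarith [h.1]⟩, Or.inl hΛI⟩,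
    fun h => hΛ ⟨-(2 * Λ.im), ⟨by linarith [h.2], by linarith [h.1]⟩, Or.inr ?_⟩⟩
  rw [hΛI, ofReal_neg, mul_neg, neg_neg]

theorem exists_eigenpair_near_base (hp : 1 ≤ p) (ha : ∀ n, (a n).im = 0) (hre : Λ.re = 0)
    (hΛ : Module.finrank ℂ (Module.End.maxGenEigenspace
      (linNLS p Ω a : (Latt d × Latt d) →ₗ[ℂ] (Latt d × Latt d)) (2 * Λ)) = 1)
    (hΛc : 2 * Λ ∉ contSpec d Ω)
    {b : Latt d × Latt d} (hb0 : b ≠ 0) (hb : linNLS p Ω a b = (2 * Λ) • b) :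
    ∃ (s : Params d → ℂ) (ψ : Params d → Modes d), AnalyticAt ℂ s (baseParams Ω a) ∧
      AnalyticAt ℂ ψ (baseParams Ω a) ∧ s (baseParams Ω a) = Λ ∧
      ψ (baseParams Ω a) = (2 : ℂ) • pairIn (polarize b) ∧
      (∀ᶠ q in 𝓝 (baseParams Ω a), spectralOp p (q, s q) (ψ q) = 0 ∧ ψ q ≠ 0) ∧
      ∀ᶠ v in 𝓝 (baseParams Ω a, Λ), ∀ F, F ≠ 0 → spectralOp p v F = 0 →
        v.2 = s v.1 ∧ ∃ c : ℂ, F = c • ψ v.1 := by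
  obtain ⟨ℓ, hℓ⟩ := SeparatingDual.exists_eq_one (R := ℂ) (polarize_ne_zero hb0)
  obtain ⟨hminus, hplus⟩ := not_mem_Icc_of_not_mem_contSpec hre hΛc
  refine exists_analytic_eigenpair (κ := 2) (ℓ := ℓ.comp pairOut) (r := pairIn (copolarize b))
    (analyticAt_spectralOp p _) two_ne_zero ?_ (fun σ => ?_) ?_
  · rw [ContinuousLinearMap.comp_apply, pairOut_two_smul_pairIn, hℓ]
  · rw [spectralOp_base, baseOp_pairIn hp Ω ha, pairOp_polarize, hb, ← sub_smul, ← mul_sub,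
      copolarize_smul, map_smul]
  · have hbij := bijective_baseOp_add hp ha hre hminus hplus
      (isCompactOperator_smulRight ℓ (copolarize b))
      (pairOp_add_smulRight_injective hΛ hb0 hb hℓ)
    have hrank : pairIn.comp ((ℓ.smulRight (copolarize b)).comp pairOut)
        = (ℓ.comp pairOut).smulRight (pairIn (copolarize b)) := by
      ext1 F
      exact map_smul pairIn _ _
    rw [hrank] at hbij
    exact ContinuousLinearMap.isUnit_iff_bijective.mpr hbij

end SpectralProblem

section EigenpairBranch

variable {d p : ℕ} {Ω : ℝ} {a : Latt d} {Λ : ℂ}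

theorem eq_wt_smul_of_eq_weighted {B : ℤ → Latt d} {F : Modes d} (h : ∀ m, F m = weighted B m) :
    B = fun m => wt m • F m :=
  funext fun m => by
    rw [h, weighted, smul_smul, wt, inv_mul_cancel₀ (one_add_sq_ne_zero m), one_smul]

theorem star_eq_of_im_wt_smul_eq_zero {F : Modes d} (h : ∀ m n, ((wt m • F m) n).im = 0) :
    star F = F := by
  refine lp.ext (funext fun m => lp.ext (funext fun n => ?_))
  have hreal : star (wt m * F m n) = wt m * F m n := conj_eq_iff_im.mpr (h m n)
  rw [star_mul', star_wt] at hreal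
  exact mul_left_cancel₀ (wt_ne_zero m) hreal

theorem tsum_int_le_of_even {f : ℤ → ℝ} (hf : Summable f) (h₀ : 0 ≤ f 0)
    (heven : ∀ m, f (-m) = f m) :
    ∑' m, f m ≤ 2 * (f 0 + f 1 + ∑' m : ℕ, f (m + 2)) := by
  have hnat : Summable fun m : ℕ => f m := hf.comp_injective Nat.cast_injective
  have hsucc : Summable fun m : ℕ => f (m + 1) := by
    simpa using (summable_nat_add_iff 1).mpr hnat
  have hneg : Summable fun m : ℕ => f (-((m : ℤ) + 1)) := by
    simpa only [heven] using hsucc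
  have hsplit₀ : ∑' m : ℕ, f m = f 0 + ∑' m : ℕ, f (m + 1) := by
    simpa using hnat.tsum_eq_zero_add
  have hsplit₁ : ∑' m : ℕ, f (m + 1) = f 1 + ∑' m : ℕ, f (m + 2) := by
    simpa [add_assoc, one_add_one_eq_two] using hsucc.tsum_eq_zero_add
  rw [tsum_of_nat_of_neg_add_one hnat hneg]
  simp only [heven]
  rw [hsplit₀, hsplit₁]
  linarith

theorem norm_fourierMul_sub_le_of_even {F : Modes d}
    (heven : ∀ m, wt (-m) • F (-m) = wt m • F m) :
    ‖fourierMul F - fourierMul ((2 : ℂ) • pairIn (a, a))‖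
      ≤ 2 * (‖wt 0 • F 0‖ + ‖wt 1 • F 1 - a‖ + ∑' m : ℕ, ‖wt (m + 2) • F (m + 2)‖) := by
  set G : Modes d := F - (2 : ℂ) • pairIn (a, a)
  have hG : ∀ m, wt m • G m = wt m • F m - pairIn (a, a) m := fun m => by
    rw [lp.coeFn_sub, Pi.sub_apply, smul_sub, ← unweight_apply ((2 : ℂ) • _),
      unweight_two_smul_pairIn]
  have hGeven : ∀ m, wt (-m) • G (-m) = wt m • G m := fun m => by
    rw [hG, hG, heven, ← reflect_apply, reflect_pairIn, Prod.swap_prod_mk]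
  have hfar : ∀ m : ℤ, ¬(m = 1 ∨ m = -1) → wt m • G m = wt m • F m := fun m hm => by
    rw [hG, pairIn_far _ hm, sub_zero]
  have hone : wt 1 • G 1 = wt 1 • F 1 - a := by rw [hG, pairIn_one]
  have htail : ∀ m : ℕ, wt ((m : ℤ) + 2) • G (m + 2) = wt (m + 2) • F (m + 2) := fun m =>
    hfar _ (by omega)
  have hsum := tsum_int_le_of_even (summable_norm_wt_smul G) (norm_nonneg _)
    fun m => congrArg norm (hGeven m)
  simp_rw [htail] at hsum
  rw [hfar 0 (by norm_num), hone] at hsum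
  rw [← map_sub]
  exact (norm_fourierMul_le G).trans hsum

theorem norm_wt_one_sub_add_le (F : Modes d) (bp bm : Latt d) :
    ‖wt 1 • F 1 - bp - I • bm‖ + ‖wt (-1) • F (-1) - bp + I • bm‖
      ≤ 2 * ‖F - (2 : ℂ) • pairIn (polarize (bp, bm))‖ := by
  set G : Modes d := F - (2 : ℂ) • pairIn (polarize (bp, bm))
  have hG : ∀ m, wt m • G m = wt m • F m - pairIn (polarize (bp, bm)) m := fun m => by
    rw [lp.coeFn_sub, Pi.sub_apply, smul_sub, ← unweight_apply ((2 : ℂ) • _),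
      unweight_two_smul_pairIn]
  have hone : wt 1 • F 1 - bp - I • bm = wt 1 • G 1 := by
    rw [hG, pairIn_one, polarize, sub_sub]
  have hnegone : wt (-1) • F (-1) - bp + I • bm = wt (-1) • G (-1) := by
    rw [hG, pairIn_neg_one, polarize, sub_add]
  rw [hone, hnegone]
  linarith [norm_wt_smul_le G 1, norm_wt_smul_le G (-1)]

theorem norm_wt_zero_add_tsum_le (F : Modes d) (z : Latt d × Latt d) :
    ‖wt 0 • F 0‖ + ∑' m : ℕ, (‖wt (m + 2) • F (m + 2)‖ + ‖wt (-(m + 2)) • F (-(m + 2))‖)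
      ≤ (1 + 2 * wtSum) * ‖F - (2 : ℂ) • pairIn z‖ := by
  set G : Modes d := F - (2 : ℂ) • pairIn z
  have hfar : ∀ m : ℤ, ¬(m = 1 ∨ m = -1) → F m = G m := fun m hm => by
    rw [lp.coeFn_sub, Pi.sub_apply, lp.coeFn_smul, Pi.smul_apply, pairIn_far _ hm, smul_zero,
      sub_zero]
  have hpos : ∀ m : ℕ, F (m + 2) = G (m + 2) := fun m => hfar _ (by omega)
  have hneg : ∀ m : ℕ, F (-(m + 2)) = G (-(m + 2)) := fun m => hfar _ (by omega)
  simp_rw [hfar 0 (by norm_num), hpos, hneg]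
  have hG := summable_norm_wt_smul G
  have hinj : Function.Injective fun m : ℕ => (m : ℤ) + 2 := fun _ _ h => by simpa using h
  have hinj_neg : Function.Injective fun m : ℕ => -((m : ℤ) + 2) := fun _ _ h => by simpa using h
  have hsum : Summable fun m : ℕ => ‖wt ((m : ℤ) + 2) • G (m + 2)‖ := hG.comp_injective hinj
  have hsum_neg : Summable fun m : ℕ => ‖wt (-((m : ℤ) + 2)) • G (-(m + 2))‖ :=
    hG.comp_injective hinj_neg
  rw [hsum.tsum_add hsum_neg]
  have hle := tsum_norm_wt_shift_le G
  have hle_neg : ∑' m : ℕ, ‖wt (-((m : ℤ) + 2)) • G (-((m : ℤ) + 2))‖ ≤ wtSum * ‖G‖ :=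
    (tsum_comp_le_tsum_of_inj hG (fun _ => norm_nonneg _) hinj_neg).trans
      (tsum_norm_wt_smul_le G)
  linarith [norm_wt_smul_le G 0]

theorem re_eq_zero_of_forall_eq_zero {ε ω δ : ℝ} (hε : ε ≠ 0) {Φ F : Modes d} (hΦ : star Φ = Φ)
    (hre : Λ.re = 0) {σ : ℂ} (hσ : ‖σ - Λ‖ < δ) (hF0 : F ≠ 0)
    (hF : spectralOp p (branchParams ε ω Φ, σ) F = 0)
    (huniq : ∀ τ : ℂ, ‖τ - Λ‖ < δ → ∀ G, G ≠ 0 →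
      spectralOp p (branchParams ε ω Φ, τ) G = 0 → τ = σ) : σ.re = 0 := by
  have hnorm : ‖-star σ - Λ‖ = ‖σ - Λ‖ := by
    have hΛ : star Λ = -Λ := by
      apply Complex.ext <;> simp [hre]
    rw [← norm_star (σ - Λ), star_sub, hΛ, ← norm_neg]
    congr 1
    ring
  have heq := congrArg re (huniq (-star σ) (hnorm ▸ hσ) (star F) (star_ne_zero.mpr hF0)
    (spectralOp_star hε hΦ hF))
  rw [neg_re, star_def, conj_re] at heq
  linarith

theorem IsEigenpair.exists_eq_wt_smul {ε ω : ℝ} {Φ : Modes d} {μ : ℂ} {B : ℤ → Latt d}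
    (h : IsEigenpair p ε ω (fun m => wt m • Φ m) μ B) (hε : ε ≠ 0) :
    ∃ F : Modes d, (B = fun m => wt m • F m) ∧ F ≠ 0 ∧
      spectralOp p (branchParams ε ω Φ, μ / ε) F = 0 := by
  obtain ⟨F, hF⟩ : ∃ F : Modes d, ∀ m, F m = weighted B m := ⟨⟨weighted B, h.mem⟩, fun _ => rfl⟩
  have hB := eq_wt_smul_of_eq_weighted hF
  have hμ : (ε : ℂ) * (μ / ε) = μ := mul_div_cancel₀ μ (ofReal_ne_zero.mpr hε)
  exact ⟨F, hB, (isEigenpair_iff hε).mp (by rwa [hμ, ← hB])⟩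

theorem IsEigenpair.eq_and_exists_eq_smul {ε ω δ : ℝ} (hε : 0 < ε) {Φ Ψ : Modes d} {σ μ : ℂ}
    {B : ℤ → Latt d} (h : IsEigenpair p ε ω (fun m => wt m • Φ m) μ B) (hμ : ‖μ - ε * Λ‖ < δ * ε)
    (huniq : ∀ τ : ℂ, ‖τ - Λ‖ < δ → ∀ G, G ≠ 0 →
      spectralOp p (branchParams ε ω Φ, τ) G = 0 → τ = σ ∧ ∃ c : ℂ, G = c • Ψ) :
    μ = ε * σ ∧ ∃ c : ℂ, B = c • fun m => wt m • Ψ m := by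
  have hεc : (ε : ℂ) ≠ 0 := ofReal_ne_zero.mpr hε.ne'
  obtain ⟨F, rfl, hF0, hF⟩ := h.exists_eq_wt_smul hε.ne'
  have hσ : ‖μ / ε - Λ‖ < δ := by
    have hdiv : μ / ε - Λ = (μ - ε * Λ) / ε := by rw [sub_div, mul_div_cancel_left₀ _ hεc]
    rwa [hdiv, norm_div, norm_real, Real.norm_of_nonneg hε.le, div_lt_iff₀ hε]
  obtain ⟨rfl, c, rfl⟩ := huniq _ hσ F hF0 hF
  exact ⟨(mul_div_cancel₀ μ hεc).symm, c, funext fun m => smul_comm (wt m) c (Ψ m)⟩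

variable {ε₁ C₁ : ℝ} {ω : ℝ → ℝ} {A : ℝ → ℤ → Latt d} {Φ : ℝ → Modes d}

theorem IsBreatherBranch.exists_modes (h : IsBreatherBranch p Ω a ε₁ C₁ ω A) :
    ∃ Φ : ℝ → Modes d, AnalyticOnNhd ℝ Φ (Set.Ioo 0 ε₁) ∧
      ∀ ε ∈ Set.Ioo 0 ε₁, A ε = fun m => wt m • Φ ε m :=
  h.analytic_coeff.imp fun _ hΦ => ⟨hΦ.1, fun ε hε => eq_wt_smul_of_eq_weighted (hΦ.2 ε hε)⟩

theorem IsBreatherBranch.isBigO_freq (h : IsBreatherBranch p Ω a ε₁ C₁ ω A) :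
    (fun ε => ω ε - 1 + ε * Ω / 2) =O[𝓝[>] 0] fun ε => ε ^ 2 :=
  .of_bound C₁ <| eventually_of_mem (Ioo_mem_nhdsGT h.pos) fun ε hε => by
    rw [Real.norm_eq_abs, Real.norm_of_nonneg (sq_nonneg ε)]
    exact h.bound_freq ε hε

theorem IsBreatherBranch.isBigO_freq_sub_one (h : IsBreatherBranch p Ω a ε₁ C₁ ω A) :
    (fun ε => ω ε - 1) =O[𝓝[>] 0] fun ε => ε := by
  have hsq : (fun ε : ℝ => ε ^ 2) =O[𝓝[>] 0] fun ε => ε :=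
    (Asymptotics.isLittleO_pow_id one_lt_two).isBigO.mono nhdsWithin_le_nhds
  have hlin : (fun ε : ℝ => ε * Ω / 2) =O[𝓝[>] 0] fun ε => ε := by
    simpa only [mul_div_assoc, mul_comm (Ω / 2)] using
      (Asymptotics.isBigO_refl (fun ε : ℝ => ε) (𝓝[>] 0)).const_mul_left (Ω / 2)
  simpa only [add_sub_cancel_right] using (h.isBigO_freq.trans hsq).sub hlin

theorem IsBreatherBranch.isBigO_detuning (h : IsBreatherBranch p Ω a ε₁ C₁ ω A) :
    (fun ε => (1 - ω ε ^ 2) / ε - Ω) =O[𝓝[>] 0] fun ε => ε := by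
  have hrem : (fun ε => 2 * (ω ε - 1 + ε * Ω / 2) + (ω ε - 1) ^ 2) =O[𝓝[>] 0] fun ε => ε ^ 2 :=
    (h.isBigO_freq.const_mul_left 2).add (h.isBigO_freq_sub_one.pow 2)
  refine (hrem.mul (Asymptotics.isBigO_refl (fun ε : ℝ => ε⁻¹) _)).neg_left.congr' ?_ ?_
  all_goals
    refine eventually_of_mem self_mem_nhdsWithin fun ε hε => ?_
    have hε0 : ε ≠ 0 := (Set.mem_Ioi.mp hε).ne'
    field_simp
  ring

theorem IsBreatherBranch.isBigO_fourierMul (h : IsBreatherBranch p Ω a ε₁ C₁ ω A)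
    (hΦ : ∀ ε ∈ Set.Ioo 0 ε₁, A ε = fun m => wt m • Φ ε m) :
    (fun ε => fourierMul (Φ ε) - fourierMul ((2 : ℂ) • pairIn (a, a))) =O[𝓝[>] 0] fun ε => ε :=
  .of_bound (2 * C₁) <| eventually_of_mem (Ioo_mem_nhdsGT h.pos) fun ε hε => by
    have hcoeff := h.bound_coeff ε hε
    have heven := (h.breather ε hε).even
    rw [hΦ ε hε] at hcoeff heven
    rw [Real.norm_of_nonneg hε.1.le, mul_assoc]
    exact (norm_fourierMul_sub_le_of_even heven).trans
      (mul_le_mul_of_nonneg_left hcoeff two_pos.le)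

theorem IsBreatherBranch.isBigO_branchParams (h : IsBreatherBranch p Ω a ε₁ C₁ ω A)
    (hΦ : ∀ ε ∈ Set.Ioo 0 ε₁, A ε = fun m => wt m • Φ ε m) :
    (fun ε => branchParams ε (ω ε) (Φ ε) - baseParams Ω a) =O[𝓝[>] 0] fun ε => ε := by
  have hofReal : ∀ {f : ℝ → ℝ} {x : ℂ} {y : ℝ}, x = y →
      (fun ε => f ε - y) =O[𝓝[>] 0] (fun ε => ε) →
      (fun ε => (f ε : ℂ) - x) =O[𝓝[>] 0] fun ε => ε := fun hxy hf =>
    (hf.norm_left.congr_left fun ε => by rw [hxy, ← ofReal_sub, norm_real]).of_norm_left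
  have hid : (fun ε : ℝ => id ε - 0) =O[𝓝[>] 0] fun ε => ε := by
    simpa using Asymptotics.isBigO_refl _ _
  exact (hofReal ofReal_zero.symm hid).prod_left
    ((hofReal ofReal_one.symm h.isBigO_freq_sub_one).prod_left
      ((hofReal rfl h.isBigO_detuning).prod_left (h.isBigO_fourierMul hΦ)))

theorem IsBreatherBranch.analyticAt_branchParams (h : IsBreatherBranch p Ω a ε₁ C₁ ω A)
    (hΦ : AnalyticOnNhd ℝ Φ (Set.Ioo 0 ε₁)) {ε : ℝ} (hε : ε ∈ Set.Ioo 0 ε₁) :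
    AnalyticAt ℝ (fun ε => branchParams ε (ω ε) (Φ ε)) ε := by
  have hω : AnalyticAt ℝ ω ε := h.analytic_freq ε hε
  have hθ : AnalyticAt ℝ (fun x => (1 - ω x ^ 2) / x) ε :=
    (analyticAt_const.sub (hω.pow 2)).div analyticAt_id hε.1.ne'
  have hM : AnalyticAt ℝ (fun x => fourierMul (Φ x)) ε :=
    ((ContinuousLinearMap.analyticAt fourierMul (Φ ε)).restrictScalars (𝕜 := ℝ)).comp (hΦ ε hε)
  exact (ofRealCLM.analyticAt ε).prod
    (((ofRealCLM.analyticAt _).comp hω).prod (((ofRealCLM.analyticAt _).comp hθ).prod hM))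

theorem IsBreatherBranch.eventually_eigenpair (hp : 1 ≤ p) (ha : ∀ n, (a n).im = 0)
    (hre : Λ.re = 0)
    (hΛ : Module.finrank ℂ (Module.End.maxGenEigenspace
      (linNLS p Ω a : (Latt d × Latt d) →ₗ[ℂ] (Latt d × Latt d)) (2 * Λ)) = 1)
    (hΛc : 2 * Λ ∉ contSpec d Ω) {b : Latt d × Latt d} (hb0 : b ≠ 0)
    (hb : linNLS p Ω a b = (2 * Λ) • b) (h : IsBreatherBranch p Ω a ε₁ C₁ ω A)
    (hΦ : AnalyticOnNhd ℝ Φ (Set.Ioo 0 ε₁))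
    (hA : ∀ ε ∈ Set.Ioo 0 ε₁, A ε = fun m => wt m • Φ ε m) :
    ∃ (δ : ℝ) (σ : ℝ → ℂ) (Ψ : ℝ → Modes d), 0 < δ ∧
      (fun ε => σ ε - Λ) =O[𝓝[>] 0] (fun ε => ε) ∧
      (fun ε => Ψ ε - (2 : ℂ) • pairIn (polarize b)) =O[𝓝[>] 0] (fun ε => ε) ∧
      ∀ᶠ ε in 𝓝[>] 0, AnalyticAt ℝ σ ε ∧ AnalyticAt ℝ Ψ ε ∧
        spectralOp p (branchParams ε (ω ε) (Φ ε), σ ε) (Ψ ε) = 0 ∧ Ψ ε ≠ 0 ∧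
        ∀ τ : ℂ, ‖τ - Λ‖ < δ → ∀ G, G ≠ 0 →
          spectralOp p (branchParams ε (ω ε) (Φ ε), τ) G = 0 →
          τ = σ ε ∧ ∃ c : ℂ, G = c • Ψ ε := by
  obtain ⟨s, ψ, hs, hψ, hs₀, hψ₀, hker, huniq⟩ :=
    exists_eigenpair_near_base hp ha hre hΛ hΛc hb0 hb
  obtain ⟨δ, hδ, hball⟩ := Metric.eventually_nhds_iff.mp huniq
  let q : ℝ → Params d := fun ε => branchParams ε (ω ε) (Φ ε)
  have hqO : (fun ε => q ε - baseParams Ω a) =O[𝓝[>] 0] fun ε => ε := h.isBigO_branchParams hA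
  have hq : Tendsto q (𝓝[>] 0) (𝓝 (baseParams Ω a)) :=
    tendsto_sub_nhds_zero_iff.mp (hqO.trans_tendsto (tendsto_id.mono_left nhdsWithin_le_nhds))
  have hqan : ∀ᶠ ε in 𝓝[>] 0, AnalyticAt ℝ q ε :=
    eventually_of_mem (Ioo_mem_nhdsGT h.pos) fun ε hε => h.analyticAt_branchParams hΦ hε
  rw [← hs₀, ← hψ₀]
  refine ⟨δ, fun ε => s (q ε), fun ε => ψ (q ε), hδ,
    (hs.differentiableAt.isBigO_sub.comp_tendsto hq).trans hqO,
    (hψ.differentiableAt.isBigO_sub.comp_tendsto hq).trans hqO, ?_⟩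
  filter_upwards [hqan, hq.eventually hs.eventually_analyticAt, hq.eventually hker,
    hq.eventually hψ.eventually_analyticAt, hq.eventually (Metric.ball_mem_nhds _ hδ)]
    with ε hqε hsε hkerε hψε hdist
  refine ⟨AnalyticAt.comp (g := s) hsε.restrictScalars hqε,
    AnalyticAt.comp (g := ψ) hψε.restrictScalars hqε, hkerε.1, hkerε.2, fun τ hτ => ?_⟩
  refine hball (y := (q ε, τ)) (max_lt hdist ?_)
  rwa [dist_eq_norm, ← hs₀]

theorem IsBreather.isEigenpair_of_spectralOp_eq_zero {ε ω δ C : ℝ} {Φ Ψ : Modes d} {σ : ℂ}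
    {bp bm : Latt d} (h : IsBreather p ε ω fun m => wt m • Φ m) (hε : 0 < ε) (hre : Λ.re = 0)
    (hC : (2 + 2 * wtSum) * ‖(σ - Λ, Ψ - (2 : ℂ) • pairIn (polarize (bp, bm)))‖ ≤ C * ε)
    (hCδ : C * ε < δ) (hker : spectralOp p (branchParams ε ω Φ, σ) Ψ = 0) (hne : Ψ ≠ 0)
    (huniq : ∀ τ : ℂ, ‖τ - Λ‖ < δ → ∀ G, G ≠ 0 →
      spectralOp p (branchParams ε ω Φ, τ) G = 0 → τ = σ ∧ ∃ c : ℂ, G = c • Ψ) :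
    IsEigenpair p ε ω (fun m => wt m • Φ m) (ε * σ) (fun m => wt m • Ψ m) ∧
    (ε * σ : ℂ).re = 0 ∧
    ‖ε * σ - ε * Λ‖ ≤ C * ε ^ 2 ∧
    ‖wt 1 • Ψ 1 - bp - I • bm‖ + ‖wt (-1) • Ψ (-1) - bp + I • bm‖ ≤ C * ε ∧
    ‖wt 0 • Ψ 0‖ + ∑' m : ℕ, (‖wt (m + 2) • Ψ (m + 2)‖ + ‖wt (-(m + 2)) • Ψ (-(m + 2))‖)
      ≤ C * ε ∧
    ∀ (μ : ℂ) (B : ℤ → Latt d), IsEigenpair p ε ω (fun m => wt m • Φ m) μ B →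
      ‖μ - ε * Λ‖ < δ * ε → μ = ε * σ ∧ ∃ c : ℂ, B = c • fun m => wt m • Ψ m := by
  have hw := wtSum_nonneg
  have hσ : ‖σ - Λ‖ ≤ C * ε := (norm_fst_le (_, Ψ - _)).trans <|
    (le_mul_of_one_le_left (norm_nonneg _) (by linarith)).trans hC
  have hΨ : (2 + 2 * wtSum) * ‖Ψ - (2 : ℂ) • pairIn (polarize (bp, bm))‖ ≤ C * ε :=
    (mul_le_mul_of_nonneg_left (norm_snd_le (σ - Λ, _)) (by positivity)).trans hC
  have hσre := re_eq_zero_of_forall_eq_zero hε.ne' (star_eq_of_im_wt_smul_eq_zero h.real) hre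
    (hσ.trans_lt hCδ) hne hker fun τ hτ G hG0 hG => (huniq τ hτ G hG0 hG).1
  refine ⟨(isEigenpair_iff hε.ne').mpr ⟨hne, hker⟩, by simp [hσre], ?_,
    (norm_wt_one_sub_add_le Ψ bp bm).trans (le_trans ?_ hΨ),
    (norm_wt_zero_add_tsum_le Ψ (polarize (bp, bm))).trans (le_trans ?_ hΨ),
    fun μ B hB hμ => hB.eq_and_exists_eq_smul hε hμ huniq⟩
  · rw [← mul_sub, norm_mul, norm_real, Real.norm_of_nonneg hε.le, sq, mul_left_comm]
    exact mul_le_mul_of_nonneg_left hσ hε.le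
  · gcongr
    linarith
  · gcongr
    linarith

theorem exists_eigenpair_branch (hp : 1 ≤ p) (ha : ∀ n, (a n).im = 0) (hre : Λ.re = 0)
    (hΛ : Module.finrank ℂ (Module.End.maxGenEigenspace
      (linNLS p Ω a : (Latt d × Latt d) →ₗ[ℂ] (Latt d × Latt d)) (2 * Λ)) = 1)
    (hΛc : 2 * Λ ∉ contSpec d Ω)
    {bp bm : Latt d} (hb0 : (bp, bm) ≠ 0) (hb : linNLS p Ω a (bp, bm) = (2 * Λ) • (bp, bm))
    (h : IsBreatherBranch p Ω a ε₁ C₁ ω A) :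
    ∃ ε₀ C₀ δ : ℝ, 0 < ε₀ ∧ ε₀ ≤ ε₁ ∧ 0 < C₀ ∧ 0 < δ ∧ C₀ * ε₀ ≤ δ ∧
      ∃ (lam : ℝ → ℂ) (B : ℝ → ℤ → Latt d),
        AnalyticOnNhd ℝ lam (Set.Ioo 0 ε₀) ∧
        AnalyticL22On B (Set.Ioo 0 ε₀) ∧
        ∀ ε ∈ Set.Ioo 0 ε₀,
          IsEigenpair p ε (ω ε) (A ε) (lam ε) (B ε) ∧
          (lam ε).re = 0 ∧
          ‖lam ε - ε * Λ‖ ≤ C₀ * ε ^ 2 ∧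
          ‖B ε 1 - bp - I • bm‖ + ‖B ε (-1) - bp + I • bm‖ ≤ C₀ * ε ∧
          ‖B ε 0‖ + ∑' m : ℕ, (‖B ε (m + 2)‖ + ‖B ε (-(m + 2))‖) ≤ C₀ * ε ∧
          ∀ (μ : ℂ) (B' : ℤ → Latt d), IsEigenpair p ε (ω ε) (A ε) μ B' →
            ‖μ - ε * Λ‖ < δ * ε → μ = lam ε ∧ ∃ c : ℂ, B' = c • B ε := by
  obtain ⟨Φ, hΦ, hA⟩ := h.exists_modes
  obtain ⟨δ, σ, Ψ, hδ, hσO, hΨO, hev⟩ := h.eventually_eigenpair hp ha hre hΛ hΛc hb0 hb hΦ hA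
  obtain ⟨C, hC, hbound⟩ := (hσO.prod_left hΨO).exists_pos
  have hw := wtSum_nonneg
  have hC₀ : 0 < (2 + 2 * wtSum) * C := by positivity
  obtain ⟨ε₀, ⟨hε₀, hε₀le⟩, hIoo⟩ := (mem_nhdsGT_iff_exists_mem_Ioc_Ioo_subset
    (lt_min h.pos (div_pos hδ hC₀))).mp (hbound.bound.and hev)
  obtain ⟨hε₀ε₁, hε₀δ⟩ := le_min_iff.mp hε₀le
  have hC₀δ : (2 + 2 * wtSum) * C * ε₀ ≤ δ := (le_div_iff₀' hC₀).mp hε₀δ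
  refine ⟨ε₀, (2 + 2 * wtSum) * C, δ, hε₀, hε₀ε₁, hC₀, hδ, hC₀δ, fun ε => ε * σ ε,
    fun ε m => wt m • Ψ ε m, fun ε hε => (ofRealCLM.analyticAt ε).mul (hIoo hε).2.1,
    ⟨Ψ, fun ε hε => (hIoo hε).2.2.1, fun ε _ m => (weighted_wt_smul (Ψ ε) m).symm⟩,
    fun ε hε => ?_⟩
  obtain ⟨hle, -, -, hker, hne, huniq⟩ := hIoo hε
  rw [Real.norm_of_nonneg hε.1.le] at hle
  have hbreather := h.breather ε ⟨hε.1, hε.2.trans_le hε₀ε₁⟩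
  rw [hA ε ⟨hε.1, hε.2.trans_le hε₀ε₁⟩] at hbreather ⊢
  refine hbreather.isEigenpair_of_spectralOp_eq_zero hε.1 hre ?_
    ((mul_lt_mul_of_pos_left hε.2 hC₀).trans_le hC₀δ) hker hne huniq
  rw [mul_assoc]
  exact mul_le_mul_of_nonneg_left hle (by positivity)

end EigenpairBranch

end

end KleinGordon

open KleinGordon in
theorem theorem3 (d p : ℕ) (hd : 1 ≤ d) (hp : 1 ≤ p)
    (Ω : ℝ) (hΩ : Ω ∉ Set.Icc (-(4 * d : ℝ)) 0)
    (a : Latt d) (ha : IsSoliton p Ω a)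
    (hJ : ∀ v : Latt d, jac p Ω a v = 0 → v = 0)
    (Λ : ℂ) (hΛim : Λ.re = 0) (hΛ0 : Λ ≠ 0)
    (hΛ : IsSimpleIsolatedEigenvalue (linNLS p Ω a) (2 * Λ))
    (hΛc : 2 * Λ ∉ contSpec d Ω)
    (bp bm : Latt d) (hb0 : (bp, bm) ≠ 0)
    (hb : linNLS p Ω a (bp, bm) = (2 * Λ) • (bp, bm)) :
    (∃ (ε₁ C₁ : ℝ) (ω : ℝ → ℝ) (A : ℝ → ℤ → Latt d), IsBreatherBranch p Ω a ε₁ C₁ ω A) ∧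
    ∀ (ε₁ C₁ : ℝ) (ω : ℝ → ℝ) (A : ℝ → ℤ → Latt d), IsBreatherBranch p Ω a ε₁ C₁ ω A →
      ∃ ε₀ C₀ δ : ℝ, 0 < ε₀ ∧ ε₀ ≤ ε₁ ∧ 0 < C₀ ∧ 0 < δ ∧ C₀ * ε₀ ≤ δ ∧
        ∃ (lam : ℝ → ℂ) (B : ℝ → ℤ → Latt d),
          AnalyticOnNhd ℝ lam (Set.Ioo 0 ε₀) ∧
          AnalyticL22On B (Set.Ioo 0 ε₀) ∧
          ∀ ε ∈ Set.Ioo 0 ε₀,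
            IsEigenpair p ε (ω ε) (A ε) (lam ε) (B ε) ∧
            (lam ε).re = 0 ∧
            ‖lam ε - ε * Λ‖ ≤ C₀ * ε ^ 2 ∧
            ‖B ε 1 - bp - Complex.I • bm‖ + ‖B ε (-1) - bp + Complex.I • bm‖ ≤ C₀ * ε ∧
            ‖B ε 0‖ + ∑' m : ℕ, (‖B ε (m + 2)‖ + ‖B ε (-(m + 2))‖) ≤ C₀ * ε ∧
            ∀ (μ : ℂ) (B' : ℤ → Latt d), IsEigenpair p ε (ω ε) (A ε) μ B' →
              ‖μ - ε * Λ‖ < δ * ε → μ = lam ε ∧ ∃ c : ℂ, B' = c • B ε :=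
  ⟨exists_breatherBranch hp hΩ ha hJ, fun _ _ _ _ h =>
    exists_eigenpair_branch hp ha.1 hΛim hΛ.simple hΛc hb0 hb h⟩
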